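/- Let $r,v,\sigma,T,\alpha_1,\alpha_2>0$ and $x_1\in\mathbb{R}$, and let $W$ be a standard Brownian motion. For $i=1,2$ let $\bar P_i(t)=\frac{v}{\alpha_i\sigma^2}e^{r(t-T)}$, $t\in[0,T]$, be the rational decision of the retail investor ($i=1$) and of the leading expert ($i=2$). For $\theta>0$ consider the problem of maximizing $$\mathbb{E}\Big[-\tfrac{1}{\alpha_1}e^{-\alpha_1X(T)}\Big]-\frac{\theta}{2}\int_0^T\big(\dot P(t)-\dot{\bar P}_2(t)\big)^2\,dt$$ over all (deterministic) $P\in C^1([0,T])$ with $\dot P(0)=\frac{rv}{\alpha_2\sigma^2}e^{-rT}$ and $\dot P(T)=\frac{rv}{\alpha_2\sigma^2}$, where $dX(t)=[rX(t)+vP(t)]\,dt+\sigma P(t)\,dW(t)$ and $X(0)=x_1$. The asymptotic decision $P^*_{1\infty}$ is the pointwise limit on $[0,T]$, as $\theta\to\infty$, of the optimal decisions of this problem. Then the asymptotic decision exists, the number $$\tau=T+\frac1r\ln\frac{e^{rT}-1}{e^{2rT}-1}+\frac{\ln 2}{r}$$ lies in $[0,T]$, and the following holds. For $t\in[0,\tau]$,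 $$P^*_{1\infty}(t)\ge\bar P_1(t)>\bar P_2(t)\ \text{ if }\alpha_1<\alpha_2,\qquad P^*_{1\infty}(t)\le\bar P_1(t)<\bar P_2(t)\ \text{ if }\alpha_1>\alpha_2;$$ for $t\in[\tau,T]$, $$\bar P_1(t)\ge P^*_{1\infty}(t)>\bar P_2(t)\ \text{ if }\alpha_1<\alpha_2,\qquad \bar P_1(t)\le P^*_{1\infty}(t)<\bar P_2(t)\ \text{ if }\alpha_1>\alpha_2.$$ -/

import Mathlib

open Set Filter Topology MeasureTheory ProbabilityTheory
open scoped NNReal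

namespace DecisionImitation

/-- The rational (Merton) decision at time `t` of an investor with risk aversion `α`, when the
interest rate is `r`, the excess return rate `v`, the volatility `σ` and the horizon `T`. -/
noncomputable def rationalDecision (r v σ T α t : ℝ) : ℝ :=
  v / (α * σ ^ 2) * Real.exp (r * (t - T))

/-- The admissible decisions: continuously differentiable functions on `[0, T]`
(one-sided derivatives at the endpoints; values outside `[0, T]` play no role). -/
def IsDecision (T : ℝ) (P : ℝ → ℝ) : Prop :=
  ContDiffOn ℝ 1 P (Icc 0 T)

/-- The decision-changing rate on `[0, T]`. -/
noncomputable def rate (T : ℝ) (P : ℝ → ℝ) (t : ℝ) : ℝ :=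
  derivWithin P (Icc 0 T) t

/-- The integral disparity `(1/2) ∫₀ᵀ (P'(t) - Q'(t))² dt` of two decisions. -/
noncomputable def integralDisparity (T : ℝ) (P Q : ℝ → ℝ) : ℝ :=
  1 / 2 * ∫ t in (0 : ℝ)..T, (rate T P t - rate T Q t) ^ 2

/-- The constant absolute risk aversion utility. -/
noncomputable def utility (α x : ℝ) : ℝ :=
  -(1 / α) * Real.exp (-α * x)

section Wealth

variable {Ω : Type*} [MeasurableSpace Ω]

/-- `M t` is the Itô integral `∫₀ᵗ P dW` for all `t ∈ [0, T]`: the limit in probability of the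
left-endpoint Riemann sums (the integrand `P` is deterministic and, in all uses, continuous). -/
def IsItoIntegral (μ : Measure Ω) (W : ℝ≥0 → Ω → ℝ) (T : ℝ) (P : ℝ → ℝ) (M : ℝ → Ω → ℝ) : Prop :=
  ∀ t ∈ Icc (0 : ℝ) T,
    TendstoInMeasure μ
      (fun (n : ℕ) (ω : Ω) => ∑ k ∈ Finset.range n,
        P (t * (k : ℝ) / n) *
          (W (Real.toNNReal (t * ((k : ℝ) + 1) / n)) ω - W (Real.toNNReal (t * (k : ℝ) / n)) ω))
      atTop (M t)

/-- `X` is a wealth process of an investor with initial wealth `x` and decision `P`: a continuous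
solution on `[0, T]` of `dX = (r X + v P) dt + σ P dW`, `X 0 = x`. -/
def IsWealth (r v σ T x : ℝ) (μ : Measure Ω) (W : ℝ≥0 → Ω → ℝ) (P : ℝ → ℝ) (X : ℝ → Ω → ℝ) :
    Prop :=
  (∀ᵐ ω ∂μ, ContinuousOn (fun t => X t ω) (Icc 0 T)) ∧
  ∃ M : ℝ → Ω → ℝ, IsItoIntegral μ W T P M ∧
    ∀ t ∈ Icc (0 : ℝ) T, ∀ᵐ ω ∂μ,
      X t ω = x + (∫ s in (0 : ℝ)..t, (r * X s ω + v * P s)) + σ * M t ω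

/-- The objective of the retail investor: expected utility of terminal wealth minus `θ` times the
integral disparity to the rational decision of the leading expert. -/
noncomputable def objective (r v σ T α₁ α₂ θ : ℝ) (μ : Measure Ω) (P : ℝ → ℝ) (X : ℝ → Ω → ℝ) :
    ℝ :=
  (∫ ω, utility α₁ (X T ω) ∂μ) -
    θ * integralDisparity T P (fun t => rationalDecision r v σ T α₂ t)

/-- The constraints on the decision: admissible, with the expert's decision-changing rate at the
initial and the terminal time. -/
def IsFeasible (r v σ T α₂ : ℝ) (P : ℝ → ℝ) : Prop :=
  IsDecision T P ∧
  rate T P 0 = r * v / (α₂ * σ ^ 2) * Real.exp (-(r * T)) ∧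
  rate T P T = r * v / (α₂ * σ ^ 2)

/-- `P` attains the supremum of the objective among all feasible decisions. Integrability of the
utility says that the expected utility is finite; since the utility is negative, its expectation
would be `-∞` otherwise, so such a decision could not compete. -/
def IsOptimal (r v σ T x₁ α₁ α₂ θ : ℝ) (μ : Measure Ω) (W : ℝ≥0 → Ω → ℝ) (P : ℝ → ℝ) : Prop :=
  IsFeasible r v σ T α₂ P ∧
  ∃ X : ℝ → Ω → ℝ, IsWealth r v σ T x₁ μ W P X ∧
    Integrable (fun ω => utility α₁ (X T ω)) μ ∧
    ∀ (Q : ℝ → ℝ) (Y : ℝ → Ω → ℝ), IsFeasible r v σ T α₂ Q → IsWealth r v σ T x₁ μ W Q Y →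
      Integrable (fun ω => utility α₁ (Y T ω)) μ →
      objective r v σ T α₁ α₂ θ μ Q Y ≤ objective r v σ T α₁ α₂ θ μ P X

/-- `Pinf` is an asymptotic decision: the limit on `[0, T]`, as the imitation coefficient `θ` tends
to infinity, of optimal decisions for `θ`. -/
def IsAsymptoticDecision (r v σ T x₁ α₁ α₂ : ℝ) (μ : Measure Ω) (W : ℝ≥0 → Ω → ℝ)
    (Pinf : ℝ → ℝ) : Prop :=
  ∃ Pstar : ℝ → ℝ → ℝ,
    (∀ θ : ℝ, 0 < θ → IsOptimal r v σ T x₁ α₁ α₂ θ μ W (Pstar θ)) ∧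
    ∀ t ∈ Icc (0 : ℝ) T, Tendsto (fun θ => Pstar θ t) atTop (𝓝 (Pinf t))

end Wealth

/-- The crossing time. -/
noncomputable def crossingTime (r T : ℝ) : ℝ :=
  T + 1 / r * Real.log ((Real.exp (r * T) - 1) / (Real.exp (2 * r * T) - 1)) + Real.log 2 / r

end DecisionImitation

/-! For a `C¹` decision the stochastic integral can be defined path by path through integration by
parts, so the linear wealth equation has an explicit solution whose value at `T` is Gaussian. The
expected utility is therefore `-(1/α₁) exp G(P)`, where `G` is a constant plus `α₁ ∫ (A P² / 2 - k
P)` with `A > 0`, and the problem is deterministic: minimise `(1/α₁) exp G(P) + (θ/2) ∫ (P' - p')²`,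
where `p` is the expert's decision.

Existence. Writing `P = p + R`, the Euler–Lagrange equation is `R'' = ε (A P - k)` with `R' = 0` at
both ends and `ε = exp G(P) / θ`. For fixed `ε` this is a linear Neumann problem solved by shooting,
continuously in `ε`; the intermediate value theorem then finds a self-consistent `ε`
(`exists_neumann_solution`). Convexity of `G` and of `exp` makes the solution a global optimum
(`exists_isOptimal`).

Limit. Every shift `p + c` by a constant is feasible with zero disparity. Comparison with it forces
`∫ (P' - p')² = O(1/θ)`, so an optimal `P` is nearly a constant shift of `p`, and the constant must
be close to the one that minimises `G` among such shifts (`tendsto_of_isOptimal`). That constant is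
`K * 2 / (exp (r T) + 1)` with `K = v/σ² (1/α₁ - 1/α₂)`, while the two rational decisions differ by
`K exp (r (t - T))`. These agree exactly at `t = τ`, and the inequalities follow from the
monotonicity of `exp` and the sign of `K`. -/

namespace DecisionImitation

/-! ### Iterated primitives and their weighted bounds -/

/-- The double primitive of `g` that vanishes to first order at `0`. -/
noncomputable def doublePrimitive (g : ℝ → ℝ) (t : ℝ) : ℝ :=
  ∫ s in (0 : ℝ)..t, ∫ u in (0 : ℝ)..s, g u

lemma hasDerivAt_primitive {g : ℝ → ℝ} (hg : Continuous g) (t : ℝ) :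
    HasDerivAt (fun t => ∫ u in (0 : ℝ)..t, g u) (g t) t :=
  intervalIntegral.integral_hasDerivAt_right (hg.intervalIntegrable _ _)
    (hg.stronglyMeasurableAtFilter _ _) hg.continuousAt

lemma continuous_primitive {g : ℝ → ℝ} (hg : Continuous g) :
    Continuous (fun t => ∫ u in (0 : ℝ)..t, g u) :=
  continuous_iff_continuousAt.2 fun t => (hasDerivAt_primitive hg t).continuousAt

lemma hasDerivAt_doublePrimitive {g : ℝ → ℝ} (hg : Continuous g) (t : ℝ) :
    HasDerivAt (doublePrimitive g) (∫ u in (0 : ℝ)..t, g u) t :=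
  hasDerivAt_primitive (continuous_primitive hg) t

lemma continuous_doublePrimitive {g : ℝ → ℝ} (hg : Continuous g) :
    Continuous (doublePrimitive g) :=
  continuous_primitive (continuous_primitive hg)

lemma doublePrimitive_add {f g : ℝ → ℝ} (hf : Continuous f) (hg : Continuous g) (t : ℝ) :
    doublePrimitive (fun u => f u + g u) t = doublePrimitive f t + doublePrimitive g t := by
  unfold doublePrimitive
  rw [← intervalIntegral.integral_add ((continuous_primitive hf).intervalIntegrable _ _)
    ((continuous_primitive hg).intervalIntegrable _ _)]
  congr 1; ext s
  exact intervalIntegral.integral_add (hf.intervalIntegrable _ _) (hg.intervalIntegrable _ _)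

lemma doublePrimitive_const_mul (c : ℝ) (g : ℝ → ℝ) (t : ℝ) :
    doublePrimitive (fun u => c * g u) t = c * doublePrimitive g t := by
  unfold doublePrimitive
  simp only [intervalIntegral.integral_const_mul]

lemma doublePrimitive_congr {f g : ℝ → ℝ} {T t : ℝ} (h : EqOn f g (Icc 0 T)) (ht : t ∈ Icc 0 T) :
    doublePrimitive f t = doublePrimitive g t := by
  refine intervalIntegral.integral_congr fun s hs => ?_
  rw [uIcc_of_le ht.1] at hs
  refine intervalIntegral.integral_congr fun u hu => ?_
  rw [uIcc_of_le hs.1] at hu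
  exact h ⟨hu.1, hu.2.trans (hs.2.trans ht.2)⟩

lemma integral_exp_mul_le {L t : ℝ} (hL : 0 < L) :
    ∫ u in (0 : ℝ)..t, Real.exp (L * u) ≤ Real.exp (L * t) / L := by
  have h : ∀ u ∈ uIcc 0 t, HasDerivAt (fun u => Real.exp (L * u) / L) (Real.exp (L * u)) u := by
    intro u _
    have := (((hasDerivAt_id u).const_mul L).exp).div_const L
    simp only [id, mul_one] at this
    rwa [mul_div_assoc, div_self hL.ne', mul_one] at this
  rw [intervalIntegral.integral_eq_sub_of_hasDerivAt h
    ((by fun_prop : Continuous fun u => Real.exp (L * u)).intervalIntegrable _ _)]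
  have : 0 < Real.exp (L * 0) / L := by positivity
  linarith

/-- Each primitive gains a factor `1 / L` against the weight `exp (L t)`, so a large `L` turns
double integration into a contraction. -/
lemma abs_doublePrimitive_le {g : ℝ → ℝ} (hg : Continuous g) {L M T t : ℝ} (hL : 0 < L)
    (hM : 0 ≤ M) (h : ∀ u ∈ Icc 0 T, |g u| ≤ M * Real.exp (L * u)) (ht : t ∈ Icc 0 T) :
    |doublePrimitive g t| ≤ M / L ^ 2 * Real.exp (L * t) := by
  have key : ∀ (f : ℝ → ℝ) (N : ℝ), Continuous f → 0 ≤ N →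
      (∀ u ∈ Icc 0 T, |f u| ≤ N * Real.exp (L * u)) → ∀ s ∈ Icc 0 T,
      |∫ u in (0 : ℝ)..s, f u| ≤ N / L * Real.exp (L * s) := by
    intro f N hf hN hb s hs
    calc |∫ u in (0 : ℝ)..s, f u| ≤ ∫ u in (0 : ℝ)..s, |f u| :=
          intervalIntegral.abs_integral_le_integral_abs hs.1
      _ ≤ ∫ u in (0 : ℝ)..s, N * Real.exp (L * u) := by
          refine intervalIntegral.integral_mono_on hs.1 (hf.abs.intervalIntegrable _ _)
            ((by fun_prop : Continuous fun u => N * Real.exp (L * u)).intervalIntegrable _ _) ?_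
          exact fun u hu => hb u ⟨hu.1, hu.2.trans hs.2⟩
      _ = N * ∫ u in (0 : ℝ)..s, Real.exp (L * u) := intervalIntegral.integral_const_mul _ _
      _ ≤ N * (Real.exp (L * s) / L) := by gcongr; exact integral_exp_mul_le hL
      _ = N / L * Real.exp (L * s) := by ring
  have := key _ (M / L) (continuous_primitive hg) (by positivity) (key g M hg hM h) t ht
  rwa [div_div, ← pow_two] at this

/-! ### Volterra equations depending on a parameter -/

/-- The Neumann series of a bounded operator, as a function of the coefficient. -/
lemma exists_continuousOn_resolvent {E : Type*} [NormedAddCommGroup E] [NormedSpace ℝ E]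
    [CompleteSpace E] (K : E →ₗ[ℝ] E) {C m : ℝ} (hK : ∀ x, ‖K x‖ ≤ C * ‖x‖) (hC : 0 ≤ C)
    (hm : m * C < 1) (g : E) :
    ∃ Z : ℝ → E, ContinuousOn Z (Icc 0 m) ∧ ∀ ε ∈ Icc 0 m, Z ε - ε • K (Z ε) = g := by
  let K' : E →L[ℝ] E := K.mkContinuous C hK
  have hKn : ‖K'‖ ≤ C := LinearMap.mkContinuous_norm_le _ hC _
  have hlt : ∀ ε ∈ Icc 0 m, ‖ε • K'‖ < 1 := by
    intro ε hε
    rw [norm_smul, Real.norm_eq_abs, abs_of_nonneg hε.1]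
    have := hε.1.trans hε.2
    calc ε * ‖K'‖ ≤ m * C := by gcongr; exact hε.2
      _ < 1 := hm
  have hu : ∀ ε ∈ Icc 0 m, IsUnit (1 - ε • K') :=
    fun ε hε => isUnit_one_sub_of_norm_lt_one (hlt ε hε)
  refine ⟨fun ε => Ring.inverse (1 - ε • K') g, ?_, ?_⟩
  -- Inversion is continuous at units of the Banach algebra of bounded operators.
  · have h1 : ContinuousOn (fun ε : ℝ => Ring.inverse (1 - ε • K')) (Icc 0 m) := by
      intro ε hε
      have h2 : ContinuousAt Ring.inverse (1 - ε • K') := by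
        simpa using NormedRing.inverse_continuousAt (hu ε hε).unit
      have h3 : ContinuousAt (fun ε : ℝ => 1 - ε • K') ε := by fun_prop
      exact (ContinuousAt.comp (f := fun ε : ℝ => 1 - ε • K') h2 h3).continuousWithinAt
    exact h1.clm_apply continuousOn_const
  · intro ε hε
    have := Ring.mul_inverse_cancel _ (hu ε hε)
    calc _ = ((1 - ε • K') * Ring.inverse (1 - ε • K')) g := rfl
      _ = g := by rw [this]; rfl

section Volterra

variable {T : ℝ}

lemma continuous_IccExtend (hT : 0 ≤ T) (f : C(Icc 0 T, ℝ)) : Continuous (IccExtend hT f) :=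
  f.continuous.Icc_extend'

/-- The twofold Volterra operator with kernel `a`, conjugated by the weight `exp (L t)`. -/
noncomputable def weightedVolterra (hT : 0 ≤ T) (a : ℝ → ℝ) (ha : Continuous a) (L : ℝ) :
    C(Icc 0 T, ℝ) →ₗ[ℝ] C(Icc 0 T, ℝ) where
  toFun f := ⟨fun t => Real.exp (-(L * t)) *
      doublePrimitive (fun u => a u * (Real.exp (L * u) * IccExtend hT f u)) t, by
    have := continuous_IccExtend hT f
    have := continuous_doublePrimitive
      (by fun_prop : Continuous fun u => a u * (Real.exp (L * u) * IccExtend hT f u))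
    fun_prop⟩
  map_add' f g := by
    have h1 := continuous_IccExtend hT f
    have h2 := continuous_IccExtend hT g
    ext t
    simp only [ContinuousMap.coe_mk, ContinuousMap.add_apply]
    rw [← mul_add, ← doublePrimitive_add (by fun_prop) (by fun_prop)]
    congr 2; funext u
    simp only [IccExtend, Function.comp, ContinuousMap.add_apply]
    ring
  map_smul' c f := by
    ext t
    simp only [ContinuousMap.coe_mk, ContinuousMap.smul_apply, RingHom.id_apply, smul_eq_mul]
    rw [mul_left_comm, ← doublePrimitive_const_mul c]
    congr 2; funext u
    simp only [IccExtend, Function.comp, ContinuousMap.smul_apply, smul_eq_mul]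
    ring

lemma norm_weightedVolterra_le (hT : 0 ≤ T) {a : ℝ → ℝ} (ha : Continuous a) {L A : ℝ}
    (hL : 0 < L) (hA : ∀ t ∈ Icc 0 T, |a t| ≤ A) (hA0 : 0 ≤ A) (f : C(Icc 0 T, ℝ)) :
    ‖weightedVolterra hT a ha L f‖ ≤ A / L ^ 2 * ‖f‖ := by
  rw [ContinuousMap.norm_le _ (by positivity)]
  intro t
  have hf := continuous_IccExtend hT f
  have := abs_doublePrimitive_le (M := A * ‖f‖) (T := T) (t := t)
    (by fun_prop : Continuous fun u => a u * (Real.exp (L * u) * IccExtend hT f u)) hL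
    (by positivity) (fun u hu => ?_) t.2
  · simp only [weightedVolterra, LinearMap.coe_mk, AddHom.coe_mk, ContinuousMap.coe_mk,
      Real.norm_eq_abs, abs_mul, Real.abs_exp]
    calc _ ≤ Real.exp (-(L * t)) * (A * ‖f‖ / L ^ 2 * Real.exp (L * t)) := by gcongr
      _ = A * ‖f‖ / L ^ 2 * (Real.exp (-(L * t)) * Real.exp (L * t)) := by ring
      _ = A / L ^ 2 * ‖f‖ := by rw [← Real.exp_add]; simp; ring
  · rw [abs_mul, abs_mul, Real.abs_exp]
    have h1 : |IccExtend hT f u| ≤ ‖f‖ := f.norm_coe_le_norm _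
    have h2 := hA u hu
    calc |a u| * (Real.exp (L * u) * |IccExtend hT f u|)
        ≤ A * (Real.exp (L * u) * ‖f‖) := by gcongr
      _ = _ := by ring

/-- The linear Volterra equation `y = g + ε ∫∫ a y` has a solution that depends continuously on
`ε`. -/
lemma exists_volterra_solution (hT : 0 ≤ T) {a : ℝ → ℝ} (ha : Continuous a) (m : ℝ)
    (g : C(Icc 0 T, ℝ)) :
    ∃ Y : ℝ → C(Icc 0 T, ℝ), ContinuousOn Y (Icc 0 m) ∧ ∀ ε ∈ Icc 0 m, ∀ t : Icc 0 T,
      Y ε t = g t + ε * doublePrimitive (fun u => a u * IccExtend hT (Y ε) u) t := by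
  obtain ⟨A, hA⟩ := isCompact_Icc.exists_bound_of_continuousOn (s := Icc 0 T) ha.continuousOn
  have hA0 : 0 ≤ A := (norm_nonneg _).trans (hA 0 ⟨le_rfl, hT⟩)
  rcases lt_or_ge m 0 with hm | hm
  · exact ⟨fun _ => 0, by simp [Icc_eq_empty hm.not_ge], by simp [Icc_eq_empty hm.not_ge]⟩
  -- Since `L ≥ 1`, this gives `m A < L ≤ L²`, which is the smallness needed for the Neumann series
  -- up to `ε = m`.
  set L : ℝ := m * A + 1 with hLdef
  have hL1 : 1 ≤ L := by have := mul_nonneg hm hA0; linarith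
  have hL : 0 < L := by linarith
  set K := weightedVolterra hT a ha L
  have hmC : m * (A / L ^ 2) < 1 := by
    rw [← mul_div_assoc, div_lt_one (by positivity)]
    nlinarith
  let w : C(Icc 0 T, ℝ) := ⟨fun t => Real.exp (L * t), by fun_prop⟩
  let w' : C(Icc 0 T, ℝ) := ⟨fun t => Real.exp (-(L * t)), by fun_prop⟩
  obtain ⟨Z, hZ, hZe⟩ := exists_continuousOn_resolvent K
    (norm_weightedVolterra_le hT ha hL hA hA0) (by positivity) hmC (w' * g)
  have hww : ∀ t : Icc 0 T, Real.exp (L * t) * Real.exp (-(L * t)) = 1 := fun t => by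
    rw [← Real.exp_add]; simp
  -- Undoing the conjugation by the weight turns the resolvent equation for `Z` back into the
  -- Volterra equation.
  refine ⟨fun ε => w * Z ε, ?_, ?_⟩
  · exact continuousOn_const.mul hZ
  · intro ε hε t
    have h2 := congrArg (fun f : C(Icc 0 T, ℝ) => f t) (hZe ε hε)
    have h3 : (K (Z ε)) t = Real.exp (-(L * t)) *
      doublePrimitive (fun u => a u * (Real.exp (L * u) * IccExtend hT (Z ε) u)) t := rfl
    have h4 : doublePrimitive (fun u => a u * IccExtend hT (w * Z ε) u) t =
        doublePrimitive (fun u => a u * (Real.exp (L * u) * IccExtend hT (Z ε) u)) t := by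
      refine doublePrimitive_congr (T := T) (fun u hu => ?_) t.2
      simp only [IccExtend_of_mem hT _ hu]
      rfl
    have h5 : Z ε t - ε * (K (Z ε)) t = Real.exp (-(L * t)) * g t := h2
    change Real.exp (L * t) * Z ε t = _
    rw [h4]
    rw [h3] at h5
    linear_combination Real.exp (L * t) * h5 + (g t + ε *
      doublePrimitive (fun u => a u * (Real.exp (L * u) * IccExtend hT (Z ε) u)) t) * hww t

end Volterra

/-! ### The Neumann problem with a self-consistent coefficient -/

lemma continuous_integral_IccExtend {T : ℝ} (hT : 0 ≤ T) {F : ℝ → ℝ → ℝ}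
    (hF : Continuous fun p : ℝ × ℝ => F p.1 p.2) :
    Continuous fun f : C(Icc 0 T, ℝ) => ∫ u in (0 : ℝ)..T, F u (IccExtend hT f u) := by
  refine intervalIntegral.continuous_parametric_intervalIntegral_of_continuous' ?_ 0 T
  have h : Continuous fun p : C(Icc 0 T, ℝ) × ℝ => p.1 (projIcc 0 T hT p.2) :=
    continuous_fst.eval (continuous_projIcc.comp continuous_snd)
  exact hF.comp (continuous_snd.prodMk h)

/-- The energy identity for `R'' = ε (a R - b)` with Neumann boundary conditions. -/
lemma neumann_energy {T ε : ℝ} (hT : 0 ≤ T) {a b R S : ℝ → ℝ} (ha : Continuous a)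
    (hb : Continuous b) (hR : Continuous R) (hS : Continuous S)
    (hRS : ∀ t ∈ Icc 0 T, HasDerivAt R (S t) t)
    (hSd : ∀ t ∈ Icc 0 T, HasDerivAt S (ε * (a t * R t - b t)) t) (h0 : S 0 = 0) (h1 : S T = 0) :
    (∫ t in (0 : ℝ)..T, S t ^ 2) + ε * ∫ t in (0 : ℝ)..T, (a t * R t ^ 2 - b t * R t) = 0 := by
  have h := intervalIntegral.integral_mul_deriv_eq_deriv_mul (a := 0) (b := T) (u := R) (v := S)
    (u' := S) (v' := fun t => ε * (a t * R t - b t))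
    (fun t ht => hRS t (by rwa [uIcc_of_le hT] at ht))
    (fun t ht => hSd t (by rwa [uIcc_of_le hT] at ht))
    (hS.intervalIntegrable _ _)
    ((by fun_prop : Continuous fun t => ε * (a t * R t - b t)).intervalIntegrable _ _)
  rw [h0, h1] at h
  have h2 : (∫ t in (0 : ℝ)..T, R t * (ε * (a t * R t - b t))) =
      ε * ∫ t in (0 : ℝ)..T, (a t * R t ^ 2 - b t * R t) := by
    rw [← intervalIntegral.integral_const_mul]
    congr 1; ext t; ring
  have h3 : (∫ t in (0 : ℝ)..T, S t * S t) = ∫ t in (0 : ℝ)..T, S t ^ 2 := by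
    congr 1; ext t; ring
  rw [h2, h3] at h
  linarith

lemma integral_sq_nonneg {T : ℝ} (hT : 0 ≤ T) (f : ℝ → ℝ) : 0 ≤ ∫ t in (0 : ℝ)..T, f t ^ 2 :=
  intervalIntegral.integral_nonneg hT fun _ _ => sq_nonneg _

/-- A solution of `R = p + ε ∫∫ (a R - b)` on `[0, T]`, written with a global first derivative. -/
lemma hasDerivAt_of_volterra {T ε p : ℝ} (hT : 0 ≤ T) {a b : ℝ → ℝ} (ha : Continuous a)
    (hb : Continuous b) (f : C(Icc 0 T, ℝ))
    (hf : ∀ t : Icc 0 T, f t = p + ε * doublePrimitive (fun u => a u * IccExtend hT f u - b u) t) :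
    ∃ R S : ℝ → ℝ, Continuous S ∧ (∀ t, HasDerivAt R (S t) t) ∧
      (∀ t ∈ Icc 0 T, HasDerivAt S (ε * (a t * R t - b t)) t) ∧ S 0 = 0 ∧
      S T = ε * (∫ u in (0 : ℝ)..T, (a u * IccExtend hT f u - b u)) ∧ R 0 = p ∧
      EqOn R (IccExtend hT f) (Icc 0 T) := by
  have hc := continuous_IccExtend hT f
  have hg : Continuous fun u => a u * IccExtend hT f u - b u := by fun_prop
  have heq : EqOn (fun t => p + ε * doublePrimitive (fun u => a u * IccExtend hT f u - b u) t)
      (IccExtend hT f) (Icc 0 T) := fun t ht => by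
    rw [IccExtend_of_mem hT _ ht, hf ⟨t, ht⟩]
  refine ⟨fun t => p + ε * doublePrimitive (fun u => a u * IccExtend hT f u - b u) t,
    fun t => ε * ∫ u in (0 : ℝ)..t, (a u * IccExtend hT f u - b u),
    (continuous_primitive hg).const_mul ε |> fun h => by simpa using h,
    fun t => ((hasDerivAt_doublePrimitive hg t).const_mul ε).const_add p, fun t ht => ?_,
    by simp, rfl, by simp [doublePrimitive], heq⟩
  have := heq ht
  simp only at this ⊢
  rw [this]
  exact (hasDerivAt_primitive hg t).const_mul ε

/-- Here `f'' = ε a f`, `f(0) = 1`, `f'(0) = 0`, and `f'(T)` is `ε` times this integral. Were it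
zero, the energy identity would give `∫ f'² + ε ∫ a f² = 0`, impossible for `ε > 0`. At `ε = 0` the
identity is void, but then `f = 1` and the integral is `∫ a > 0`. -/
lemma integral_mul_volterra_ne_zero {T ε : ℝ} (hT : 0 < T) (hε : 0 ≤ ε) {a : ℝ → ℝ}
    (ha : Continuous a) (hpos : ∀ t, 0 < a t) (f : C(Icc 0 T, ℝ))
    (hf : ∀ t : Icc 0 T, f t = 1 + ε * doublePrimitive (fun u => a u * IccExtend hT.le f u) t) :
    ∫ u in (0 : ℝ)..T, a u * IccExtend hT.le f u ≠ 0 := by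
  intro hzero
  obtain ⟨R, S, hSc, hRS, hSd, hS0, hST, hR0, hRf⟩ :=
    hasDerivAt_of_volterra (ε := ε) (p := 1) (b := fun _ => 0) hT.le ha continuous_const f
      (by simpa using hf)
  have hRc : Continuous R := continuous_iff_continuousAt.2 fun t => (hRS t).continuousAt
  have hen := neumann_energy hT.le ha continuous_const hRc hSc (fun t _ => hRS t) hSd hS0
    (by rw [hST]; simp [hzero])
  have hposint : 0 < ∫ t in (0 : ℝ)..T, a t * R t ^ 2 := by
    refine intervalIntegral.integral_pos hT (by fun_prop) (fun t _ => ?_)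
      ⟨0, ⟨le_rfl, hT.le⟩, ?_⟩
    · have := hpos t; positivity
    · rw [hR0]; simpa using hpos 0
  have hsq := integral_sq_nonneg hT.le S
  simp only [zero_mul, sub_zero] at hen
  rcases hε.eq_or_lt with h | h
  · have h1 : ∀ t : Icc 0 T, f t = 1 := fun t => by rw [hf t, ← h]; simp
    have h2 : (∫ u in (0 : ℝ)..T, a u * IccExtend hT.le f u) = ∫ u in (0 : ℝ)..T, a u := by
      congr 1; ext u; simp [IccExtend, h1]
    have h3 : 0 < ∫ u in (0 : ℝ)..T, a u :=
      intervalIntegral.intervalIntegral_pos_of_pos (ha.intervalIntegrable _ _) hpos hT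
    linarith
  · have := mul_pos h hposint
    linarith

/-- The Neumann problem `R'' = ε (a R - b)` with a coefficient `ε` that depends on the solution
through `ε = c exp (κ ∫ (a R² / 2 - b R))`. -/
theorem exists_neumann_solution {T κ c : ℝ} (hT : 0 < T) (hκ : 0 < κ) (hc : 0 < c) {a b : ℝ → ℝ}
    (ha : Continuous a) (hb : Continuous b) (hpos : ∀ t, 0 < a t) :
    ∃ (R S : ℝ → ℝ) (ε : ℝ), Continuous S ∧ (∀ t, HasDerivAt R (S t) t) ∧
      (∀ t ∈ Icc 0 T, HasDerivAt S (ε * (a t * R t - b t)) t) ∧ S 0 = 0 ∧ S T = 0 ∧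
      ε = c * Real.exp (κ * ∫ t in (0 : ℝ)..T, (a t * R t ^ 2 / 2 - b t * R t)) := by
  -- Shooting: `p U + ε Z` solves `R = p + ε ∫∫ (a R - b)` for every initial value `p`.
  obtain ⟨U, hUc, hU⟩ := exists_volterra_solution hT.le ha c 1
  obtain ⟨Z, hZc, hZ⟩ := exists_volterra_solution hT.le ha c
    ⟨fun t => -doublePrimitive b t, by have := continuous_doublePrimitive hb; fun_prop⟩
  set N : ℝ → ℝ := fun ε => ∫ u in (0 : ℝ)..T, a u * IccExtend hT.le (U ε) u with hN
  have hN0 : ∀ ε ∈ Icc 0 c, N ε ≠ 0 := fun ε hε =>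
    integral_mul_volterra_ne_zero hT hε.1 ha hpos (U ε) (by simpa using hU ε hε)
  set I : C(Icc 0 T, ℝ) → ℝ := fun f => ∫ u in (0 : ℝ)..T, a u * IccExtend hT.le f u with hI
  have hIc : Continuous I := continuous_integral_IccExtend hT.le (F := fun u x => a u * x)
    (by fun_prop)
  -- The initial value is fixed by `∫ (a R - b) = 0` rather than by `R'(T) = ε ∫ (a R - b) = 0`. The
  -- former stays nondegenerate at `ε = 0`, so `p` is continuous on all of `[0, c]`.
  set p : ℝ → ℝ := fun ε => ((∫ u in (0 : ℝ)..T, b u) - ε * I (Z ε)) / N ε with hp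
  have hpc : ContinuousOn p (Icc 0 c) := by
    refine ContinuousOn.div ?_ (hIc.comp_continuousOn hUc) hN0
    exact continuousOn_const.sub (continuousOn_id.mul (hIc.comp_continuousOn hZc))
  set Y : ℝ → C(Icc 0 T, ℝ) := fun ε => p ε • U ε + ε • Z ε with hY
  have hYc : ContinuousOn Y (Icc 0 c) := (hpc.smul hUc).add (continuousOn_id.smul hZc)
  have hYext : ∀ ε u, IccExtend hT.le (Y ε) u =
      p ε * IccExtend hT.le (U ε) u + ε * IccExtend hT.le (Z ε) u := fun ε u => rfl
  have hYeq : ∀ ε ∈ Icc 0 c, ∀ t : Icc 0 T, Y ε t =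
      p ε + ε * doublePrimitive (fun u => a u * IccExtend hT.le (Y ε) u - b u) t := by
    intro ε hε t
    have c1 := continuous_IccExtend hT.le (U ε)
    have c2 := continuous_IccExtend hT.le (Z ε)
    have h1 : (fun u => a u * IccExtend hT.le (Y ε) u - b u) = fun u =>
        p ε * (a u * IccExtend hT.le (U ε) u) +
          (ε * (a u * IccExtend hT.le (Z ε) u) + (-1) * b u) := by
      ext u; rw [hYext]; ring
    rw [h1, doublePrimitive_add (by fun_prop) (by fun_prop),
      doublePrimitive_add (by fun_prop) (by fun_prop), doublePrimitive_const_mul,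
      doublePrimitive_const_mul, doublePrimitive_const_mul]
    have h2 := hU ε hε t
    have h3 := hZ ε hε t
    change p ε * U ε t + ε * Z ε t = _
    simp only [ContinuousMap.one_apply] at h2
    simp only [ContinuousMap.coe_mk] at h3
    linear_combination p ε * h2 + ε * h3
  have hYint : ∀ ε ∈ Icc 0 c, ∫ u in (0 : ℝ)..T, (a u * IccExtend hT.le (Y ε) u - b u) = 0 := by
    intro ε hε
    have c1 := continuous_IccExtend hT.le (U ε)
    have c2 := continuous_IccExtend hT.le (Z ε)
    have h1 : (∫ u in (0 : ℝ)..T, (a u * IccExtend hT.le (Y ε) u - b u)) =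
        p ε * N ε + ε * I (Z ε) - ∫ u in (0 : ℝ)..T, b u := by
      rw [hN, hI]
      simp only
      rw [← intervalIntegral.integral_const_mul, ← intervalIntegral.integral_const_mul,
        ← intervalIntegral.integral_add, ← intervalIntegral.integral_sub]
      · congr 1; ext u; rw [hYext]; ring
      all_goals exact Continuous.intervalIntegrable (by fun_prop) _ _
    rw [h1, hp]
    simp only
    rw [div_mul_cancel₀ _ (hN0 ε hε)]
    ring
  set Γ : C(Icc 0 T, ℝ) → ℝ := fun f => ∫ u in (0 : ℝ)..T,
    (a u * IccExtend hT.le f u ^ 2 / 2 - b u * IccExtend hT.le f u) with hΓ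
  have hΓc : Continuous Γ := continuous_integral_IccExtend hT.le
    (F := fun u x => a u * x ^ 2 / 2 - b u * x) (by fun_prop)
  set h : ℝ → ℝ := fun ε => ε - c * Real.exp (κ * Γ (Y ε)) with hh
  have hhc : ContinuousOn h (Icc 0 c) := by
    have := hΓc.comp_continuousOn hYc
    exact continuousOn_id.sub (continuousOn_const.mul (Real.continuous_exp.comp_continuousOn
      (continuousOn_const.mul this)))
  have sol : ∀ ε ∈ Icc 0 c, ∃ R S : ℝ → ℝ, Continuous S ∧ (∀ t, HasDerivAt R (S t) t) ∧
      (∀ t ∈ Icc 0 T, HasDerivAt S (ε * (a t * R t - b t)) t) ∧ S 0 = 0 ∧ S T = 0 ∧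
      Γ (Y ε) = ∫ t in (0 : ℝ)..T, (a t * R t ^ 2 / 2 - b t * R t) := by
    intro ε hε
    obtain ⟨R, S, hSc, hRS, hSd, hS0, hST, -, hRf⟩ :=
      hasDerivAt_of_volterra hT.le ha hb (Y ε) (hYeq ε hε)
    refine ⟨R, S, hSc, hRS, hSd, hS0, by rw [hST, hYint ε hε, mul_zero], ?_⟩
    refine intervalIntegral.integral_congr fun t ht => ?_
    rw [uIcc_of_le hT.le] at ht
    simp only [hRf ht]
  -- The energy identity gives `∫ (a R² - b R) ≤ 0`, and halving the square term only decreases the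
  -- integral. Hence `h c ≥ 0`, the upper sign needed for the intermediate value theorem.
  have hle : Γ (Y c) ≤ 0 := by
    obtain ⟨R, S, hSc, hRS, hSd, hS0, hST, hG⟩ := sol c ⟨hc.le, le_rfl⟩
    have hRc : Continuous R := continuous_iff_continuousAt.2 fun t => (hRS t).continuousAt
    have hen := neumann_energy hT.le ha hb hRc hSc (fun t _ => hRS t) hSd hS0 hST
    have hsq := integral_sq_nonneg hT.le S
    have h1 : (∫ t in (0 : ℝ)..T, (a t * R t ^ 2 - b t * R t)) ≤ 0 := by
      by_contra! h
      have := mul_pos hc h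
      linarith
    rw [hG]
    refine le_trans (intervalIntegral.integral_mono_on hT.le ?_ ?_ fun t _ => ?_) h1
    · exact Continuous.intervalIntegrable (by fun_prop) _ _
    · exact Continuous.intervalIntegrable (by fun_prop) _ _
    · have := mul_nonneg (hpos t).le (sq_nonneg (R t))
      linarith
  have hmem : (0 : ℝ) ∈ Icc (h 0) (h c) := by
    constructor
    · have := mul_pos hc (Real.exp_pos (κ * Γ (Y 0)))
      simp only [hh]; linarith
    · have h1 : Real.exp (κ * Γ (Y c)) ≤ 1 :=
        Real.exp_le_one_iff.2 (mul_nonpos_of_nonneg_of_nonpos hκ.le hle)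
      simp only [hh]; nlinarith
  obtain ⟨ε, hε, hzero⟩ := intermediate_value_Icc hc.le hhc hmem
  obtain ⟨R, S, hSc, hRS, hSd, hS0, hST, hG⟩ := sol ε hε
  refine ⟨R, S, ε, hSc, hRS, hSd, hS0, hST, ?_⟩
  rw [← hG]
  simp only [hh] at hzero
  linarith

/-! ### Pathwise integration against a continuous path -/

/-- The Riemann–Stieltjes integral `∫₀ᵗ ψ dw` against a continuous path `w`, for `ψ` with
derivative `ψ'`, defined by integration by parts. -/
noncomputable def pathIntegral (ψ ψ' w : ℝ → ℝ) (t : ℝ) : ℝ :=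
  ψ t * w t - ψ 0 * w 0 - ∫ s in (0 : ℝ)..t, ψ' s * w s

lemma sum_mul_sub_eq (n : ℕ) (ψ w : ℕ → ℝ) :
    ∑ k ∈ Finset.range n, ψ k * (w (k + 1) - w k) =
      ψ n * w n - ψ 0 * w 0 - ∑ k ∈ Finset.range n, (ψ (k + 1) - ψ k) * w (k + 1) := by
  rw [← Finset.sum_range_sub (fun k => ψ k * w k), ← Finset.sum_sub_distrib]
  exact Finset.sum_congr rfl fun k _ => by ring

/-- Summation by parts moves the differences onto `ψ`. The error becomes a sum of integrals of `ψ'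
(w - w(endpoint))` over the mesh, small by uniform continuity of `w`; bounded variation of `w` is
not needed. -/
lemma tendsto_sum_pathIntegral {ψ ψ' w : ℝ → ℝ} (hψ : ∀ t, HasDerivAt ψ (ψ' t) t)
    (hψ' : Continuous ψ') (hw : Continuous w) {t : ℝ} (ht : 0 ≤ t) :
    Tendsto (fun n : ℕ => ∑ k ∈ Finset.range n,
      ψ (t * (k : ℝ) / n) * (w (t * ((k : ℝ) + 1) / n) - w (t * (k : ℝ) / n)))
      atTop (𝓝 (pathIntegral ψ ψ' w t)) := by
  obtain ⟨C, hC⟩ := isCompact_Icc.exists_bound_of_continuousOn (s := Icc 0 t) hψ'.continuousOn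
  have hC0 : 0 ≤ C := (norm_nonneg _).trans (hC 0 ⟨le_rfl, ht⟩)
  have huc : UniformContinuousOn w (Icc 0 t) :=
    isCompact_Icc.uniformContinuousOn_of_continuous hw.continuousOn
  rw [Metric.tendsto_atTop]
  intro η hη
  set η' : ℝ := η / (C * t + 1) with hη'
  have hden : 0 < C * t + 1 := by positivity
  have hη'0 : 0 < η' := by positivity
  obtain ⟨δ, hδ, hunif⟩ := Metric.uniformContinuousOn_iff.1 huc η' hη'0
  obtain ⟨N, hN⟩ := exists_nat_gt (t / δ)
  refine ⟨max N 1, fun n hn => ?_⟩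
  have hn1 : 1 ≤ n := (le_max_right _ _).trans hn
  have hn0 : (0 : ℝ) < n := by exact_mod_cast hn1
  have hNn : (N : ℝ) ≤ n := by exact_mod_cast (le_max_left _ _).trans hn
  have hmesh : t / n < δ := by
    rw [div_lt_iff₀ hn0]
    rw [div_lt_iff₀ hδ] at hN
    nlinarith
  set g : ℕ → ℝ := fun k => t * (k : ℝ) / n with hg
  have hgs : ∀ k : ℕ, t * ((k : ℝ) + 1) / n = g (k + 1) := fun k => by simp [hg]
  have hg0 : g 0 = 0 := by simp [hg]
  have hgn : g n = t := by simp only [hg]; field_simp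
  have hgd : ∀ k, g (k + 1) - g k = t / n := fun k => by simp only [hg]; push_cast; field_simp; ring
  have hgle : ∀ k, g k ≤ g (k + 1) := fun k => by
    have := hgd k; have : 0 ≤ t / n := by positivity
    linarith
  have hgmem : ∀ k, k ≤ n → g k ∈ Icc 0 t := fun k hk => by
    have hk' : (k : ℝ) ≤ n := by exact_mod_cast hk
    refine ⟨by simp only [hg]; positivity, ?_⟩
    simp only [hg]
    rw [div_le_iff₀ hn0]
    gcongr
  simp_rw [hgs]
  rw [sum_mul_sub_eq n (fun k => ψ (g k)) (fun k => w (g k))]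
  have hci : ∀ a b, IntervalIntegrable (fun s => ψ' s * w s) volume a b := fun a b =>
    (hψ'.mul hw).intervalIntegrable _ _
  have hsplit : ∫ s in (0 : ℝ)..t, ψ' s * w s =
      ∑ k ∈ Finset.range n, ∫ s in g k..g (k + 1), ψ' s * w s := by
    rw [intervalIntegral.sum_integral_adjacent_intervals fun k _ => hci _ _, hg0, hgn]
  have hterm : ∀ k, (ψ (g (k + 1)) - ψ (g k)) * w (g (k + 1)) =
      ∫ s in g k..g (k + 1), ψ' s * w (g (k + 1)) := fun k => by
    rw [intervalIntegral.integral_mul_const, intervalIntegral.integral_eq_sub_of_hasDerivAt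
      (fun x _ => hψ x) (hψ'.intervalIntegrable _ _)]
  rw [dist_eq_norm]
  have hdiff : (ψ (g n) * w (g n) - ψ (g 0) * w (g 0) -
      ∑ k ∈ Finset.range n, (ψ (g (k + 1)) - ψ (g k)) * w (g (k + 1))) - pathIntegral ψ ψ' w t =
      ∑ k ∈ Finset.range n, ∫ s in g k..g (k + 1), ψ' s * (w s - w (g (k + 1))) := by
    rw [pathIntegral, hsplit, hgn, hg0, sub_sub_sub_cancel_left, ← Finset.sum_sub_distrib]
    refine Finset.sum_congr rfl fun k _ => ?_
    rw [hterm, ← intervalIntegral.integral_sub (hci _ _)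
      (Continuous.intervalIntegrable (by fun_prop) _ _)]
    congr 1; ext s; ring
  rw [hdiff]
  calc _ ≤ ∑ k ∈ Finset.range n, ‖∫ s in g k..g (k + 1), ψ' s * (w s - w (g (k + 1)))‖ :=
        norm_sum_le _ _
    _ ≤ ∑ k ∈ Finset.range n, C * η' * (t / n) := by
        refine Finset.sum_le_sum fun k hk => ?_
        have hk' : k < n := Finset.mem_range.1 hk
        have m1 := hgmem k hk'.le
        have m2 := hgmem (k + 1) hk'
        rw [← hgd k, ← abs_of_nonneg (sub_nonneg.2 (hgle k))]
        refine intervalIntegral.norm_integral_le_of_norm_le_const fun s hs => ?_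
        rw [uIoc_of_le (hgle k)] at hs
        have ms : s ∈ Icc 0 t := ⟨m1.1.trans hs.1.le, hs.2.trans m2.2⟩
        rw [norm_mul]
        have h1 : dist s (g (k + 1)) < δ := by
          rw [Real.dist_eq, abs_sub_comm, abs_of_nonneg (sub_nonneg.2 hs.2)]
          have := hgd k
          linarith [hs.1]
        have h2 := (hunif s ms _ m2 h1).le
        rw [dist_eq_norm] at h2
        exact mul_le_mul (hC s ms) h2 (norm_nonneg _) hC0
    _ = C * t * η' := by simp; field_simp
    _ < η := by
        rw [hη', ← mul_div_assoc, div_lt_iff₀ hden]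
        nlinarith

lemma continuous_pathIntegral {ψ ψ' w : ℝ → ℝ} (hψ : ∀ t, HasDerivAt ψ (ψ' t) t)
    (hψ' : Continuous ψ') (hw : Continuous w) : Continuous (pathIntegral ψ ψ' w) := by
  have h1 : Continuous ψ := continuous_iff_continuousAt.2 fun t => (hψ t).continuousAt
  have h2 := continuous_primitive (hψ'.mul hw)
  unfold pathIntegral
  exact ((h1.mul hw).sub continuous_const).sub h2

/-- Left Riemann sums of the square of a continuously differentiable function. -/
lemma tendsto_sum_sq {ψ ψ' : ℝ → ℝ} (hψ : ∀ t, HasDerivAt ψ (ψ' t) t) (hψ' : Continuous ψ')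
    {t : ℝ} (ht : 0 ≤ t) :
    Tendsto (fun n : ℕ => ∑ k ∈ Finset.range n,
      ψ (t * (k : ℝ) / n) ^ 2 * (t * ((k : ℝ) + 1) / n - t * (k : ℝ) / n))
      atTop (𝓝 (∫ s in (0 : ℝ)..t, ψ s ^ 2)) := by
  have hc : Continuous ψ := continuous_iff_continuousAt.2 fun t => (hψ t).continuousAt
  have hd : ∀ t, HasDerivAt (fun t => ψ t ^ 2) (2 * ψ t * ψ' t) t := fun t => by
    simpa using (hψ t).fun_pow 2
  -- These are Stieltjes sums against the identity path, and integration by parts identifies the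
  -- limit.
  have h := tendsto_sum_pathIntegral (w := fun s => s) hd (by fun_prop) continuous_id ht
  convert h using 2
  have := intervalIntegral.integral_mul_deriv_eq_deriv_mul (a := 0) (b := t)
    (u := fun t => ψ t ^ 2) (v := fun s => s) (u' := fun t => 2 * ψ t * ψ' t) (v' := fun _ => 1)
    (fun t _ => hd t) (fun t _ => hasDerivAt_id t)
    (Continuous.intervalIntegrable (by fun_prop) _ _) (by simp)
  simpa [pathIntegral] using this

/-! ### The Gaussian law of the Wiener integral -/

section Gaussian

variable {Ω : Type*} [MeasurableSpace Ω] {μ : Measure Ω}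

lemma hasLaw_sum_increments [IsProbabilityMeasure μ] {W : ℝ≥0 → Ω → ℝ} (hW : IsPreBrownianReal W μ)
    {τ : ℕ → ℝ≥0} (hτ : Monotone τ) (c : ℕ → ℝ) (n : ℕ) :
    HasLaw (fun ω => ∑ k ∈ Finset.range n, c k * (W (τ (k + 1)) ω - W (τ k) ω))
      (gaussianReal 0 (∑ k ∈ Finset.range n,
        .mk (c k ^ 2) (sq_nonneg _) * nndist (τ (k + 1)).1 (τ k).1)) μ := by
  have hind : iIndepFun (fun k ω => c k * (W (τ (k + 1)) ω - W (τ k) ω)) μ :=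
    (hW.hasIndepIncrements.nat hτ).comp (fun k x => c k * x) (fun k => by fun_prop)
  have hlaw : ∀ k, HasLaw (fun ω => c k * (W (τ (k + 1)) ω - W (τ k) ω))
      (gaussianReal 0 (.mk (c k ^ 2) (sq_nonneg _) * nndist (τ (k + 1)).1 (τ k).1)) μ := fun k => by
    simpa using gaussianReal_const_mul (hW.hasLaw_sub (τ (k + 1)) (τ k)) (c k)
  induction n with
  | zero =>
    simp only [Finset.range_zero, Finset.sum_empty]
    refine ⟨by fun_prop, ?_⟩
    simp
  | succ n ih =>
    have h1 := hind.indepFun_finsetSum_of_notMem₀ (fun k => (hlaw k).aemeasurable)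
      (s := Finset.range n) (i := n) (by simp)
    have h2 := gaussianReal_add_gaussianReal_of_indepFun (m₁ := 0) (m₂ := 0) h1
      (by convert ih.map_eq using 2; ext ω; simp) (hlaw n).map_eq
    refine ⟨?_, ?_⟩
    · simp_rw [Finset.sum_range_succ]
      exact ih.aemeasurable.add (hlaw n).aemeasurable
    · rw [add_zero] at h2
      rw [Finset.sum_range_succ, ← h2]
      congr 1; ext ω; simp [Finset.sum_range_succ]

/-- Characteristic functions converge to that of `Y` by dominated convergence and to the Gaussian
one by continuity in the variance. The degenerate case `V = 0` needs no separate treatment. -/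
lemma hasLaw_gaussianReal_of_tendsto [IsProbabilityMeasure μ] {X : ℕ → Ω → ℝ} {Y : Ω → ℝ}
    {v : ℕ → ℝ≥0} {V : ℝ≥0} (hX : ∀ n, HasLaw (X n) (gaussianReal 0 (v n)) μ)
    (hv : Tendsto (fun n => (v n : ℝ)) atTop (𝓝 V))
    (hXY : ∀ᵐ ω ∂μ, Tendsto (fun n => X n ω) atTop (𝓝 (Y ω))) :
    HasLaw Y (gaussianReal 0 V) μ := by
  have hY : AEMeasurable Y μ := aemeasurable_of_tendsto_metrizable_ae' (fun n => (hX n).aemeasurable) hXY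
  have := Measure.isProbabilityMeasure_map hY
  refine ⟨hY, Measure.ext_of_charFun (funext fun u => ?_)⟩
  have hmap : ∀ {Z : Ω → ℝ}, AEMeasurable Z μ →
      charFun (μ.map Z) u = ∫ ω, Complex.exp (u * Z ω * Complex.I) ∂μ := fun hZ => by
    rw [charFun_apply_real, integral_map hZ]
    exact Continuous.aestronglyMeasurable (by fun_prop)
  have h1 : Tendsto (fun n => charFun (μ.map (X n)) u) atTop (𝓝 (charFun (μ.map Y) u)) := by
    simp_rw [hmap hY, hmap (hX _).aemeasurable]
    refine tendsto_integral_of_dominated_convergence (fun _ => 1) (fun n => ?_)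
      (integrable_const _) (fun n => ?_) ?_
    · have := (hX n).aemeasurable
      exact AEMeasurable.aestronglyMeasurable (by fun_prop)
    · refine Eventually.of_forall fun ω => ?_
      rw [← Complex.ofReal_mul, Complex.norm_exp_ofReal_mul_I]
    · filter_upwards [hXY] with ω hω
      exact (Continuous.tendsto (by fun_prop : Continuous fun x : ℝ =>
        Complex.exp (u * x * Complex.I)) _).comp hω
  have h2 : Tendsto (fun n => charFun (μ.map (X n)) u) atTop
      (𝓝 (charFun (gaussianReal 0 V) u)) := by
    simp_rw [fun n => (hX n).map_eq, charFun_gaussianReal]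
    exact (Continuous.tendsto (by fun_prop : Continuous fun x : ℝ =>
      Complex.exp (u * (0 : ℝ) * Complex.I - x * u ^ 2 / 2)) _).comp hv
  exact tendsto_nhds_unique h1 h2

variable {W : ℝ≥0 → Ω → ℝ}

lemma ae_tendsto_sum_pathIntegral (hW : IsBrownianReal W μ) {ψ ψ' : ℝ → ℝ}
    (hψ : ∀ t, HasDerivAt ψ (ψ' t) t) (hψ' : Continuous ψ') {t : ℝ} (ht : 0 ≤ t) :
    ∀ᵐ ω ∂μ, Tendsto (fun n : ℕ => ∑ k ∈ Finset.range n, ψ (t * (k : ℝ) / n) *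
      (W (Real.toNNReal (t * ((k : ℝ) + 1) / n)) ω - W (Real.toNNReal (t * (k : ℝ) / n)) ω))
      atTop (𝓝 (pathIntegral ψ ψ' (fun s => W s.toNNReal ω) t)) := by
  filter_upwards [hW.cont] with ω hω
  exact tendsto_sum_pathIntegral hψ hψ' (w := fun s => W s.toNNReal ω)
    (hω.comp continuous_real_toNNReal) ht

/-- The pathwise integral is the Itô integral. -/
lemma isItoIntegral_pathIntegral [IsProbabilityMeasure μ] (hW : IsBrownianReal W μ) {T : ℝ}
    {ψ ψ' : ℝ → ℝ} (hψ : ∀ t, HasDerivAt ψ (ψ' t) t) (hψ' : Continuous ψ') :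
    IsItoIntegral μ W T ψ (fun t ω => pathIntegral ψ ψ' (fun s => W s.toNNReal ω) t) := by
  intro t ht
  refine tendstoInMeasure_of_tendsto_ae (fun n => ?_) (ae_tendsto_sum_pathIntegral hW hψ hψ' ht.1)
  refine AEMeasurable.aestronglyMeasurable (Finset.aemeasurable_fun_sum _ fun k _ => ?_)
  exact ((hW.aemeasurable _).sub (hW.aemeasurable _)).const_mul _

/-- The Wiener integral is centered Gaussian, with the variance given by the Itô isometry. -/
lemma hasLaw_pathIntegral [IsProbabilityMeasure μ] (hW : IsBrownianReal W μ) {ψ ψ' : ℝ → ℝ}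
    (hψ : ∀ t, HasDerivAt ψ (ψ' t) t) (hψ' : Continuous ψ') {t : ℝ} (ht : 0 ≤ t) :
    HasLaw (fun ω => pathIntegral ψ ψ' (fun s => W s.toNNReal ω) t)
      (gaussianReal 0 (∫ s in (0 : ℝ)..t, ψ s ^ 2).toNNReal) μ := by
  have hmono : ∀ n : ℕ, Monotone fun k : ℕ => (t * (k : ℝ) / n).toNNReal := fun n i j hij => by
    have : (i : ℝ) ≤ j := by exact_mod_cast hij
    exact Real.toNNReal_le_toNNReal (by gcongr)
  refine hasLaw_gaussianReal_of_tendsto (fun n => hasLaw_sum_increments hW.toIsPreBrownianReal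
    (hmono n) (fun k => ψ (t * (k : ℝ) / n)) n) ?_ ?_
  · rw [Real.coe_toNNReal _ (integral_sq_nonneg ht ψ)]
    refine (tendsto_sum_sq hψ hψ' ht).congr fun n => ?_
    rw [NNReal.coe_sum]
    refine Finset.sum_congr rfl fun k _ => ?_
    have h0 : 0 ≤ t * (k : ℝ) / n := by positivity
    have h1 : 0 ≤ t * ((k : ℝ) + 1) / n := by positivity
    have h2 : t * (k : ℝ) / n ≤ t * ((k : ℝ) + 1) / n := by gcongr; linarith
    rw [NNReal.coe_mul, coe_nndist, Real.dist_eq]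
    push_cast
    simp only [NNReal.val_eq_coe]
    rw [Real.coe_toNNReal _ h0, Real.coe_toNNReal _ h1, abs_of_nonneg (by linarith)]
  · filter_upwards [ae_tendsto_sum_pathIntegral hW hψ hψ' ht] with ω hω
    simpa using hω

end Gaussian

/-! ### Extension of decisions beyond the horizon -/

section Decisions

variable {T : ℝ}

lemma rate_eq_of_hasDerivAt (hT : 0 < T) {Q Q' : ℝ → ℝ} (hQ : ∀ t, HasDerivAt Q (Q' t) t) {t : ℝ}
    (ht : t ∈ Icc 0 T) : rate T Q t = Q' t :=
  (hQ t).hasDerivWithinAt.derivWithin (uniqueDiffOn_Icc hT t ht)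

lemma isDecision_of_hasDerivAt {Q Q' : ℝ → ℝ} (hQ : ∀ t, HasDerivAt Q (Q' t) t)
    (hQ' : Continuous Q') : IsDecision T Q := by
  refine ContDiff.contDiffOn (contDiff_one_iff_deriv.2 ⟨fun t => (hQ t).differentiableAt, ?_⟩)
  rwa [show deriv Q = Q' from funext fun t => (hQ t).deriv]

/-- A decision on `[0, T]` is the restriction of a continuously differentiable function. -/
lemma IsDecision.exists_extension (hT : 0 < T) {P : ℝ → ℝ} (hP : IsDecision T P) :
    ∃ Q Q' : ℝ → ℝ, (∀ t, HasDerivAt Q (Q' t) t) ∧ Continuous Q' ∧ EqOn P Q (Icc 0 T) ∧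
      EqOn (rate T P) Q' (Icc 0 T) := by
  have hc : ContinuousOn (rate T P) (Icc 0 T) :=
    hP.continuousOn_derivWithin (uniqueDiffOn_Icc hT) le_rfl
  set Q' : ℝ → ℝ := IccExtend hT.le ((Icc 0 T).domRestrict (rate T P)) with hQ'
  have hQc : Continuous Q' := (continuousOn_iff_continuous_domRestrict.1 hc).Icc_extend'
  have hQe : EqOn (rate T P) Q' (Icc 0 T) := fun t ht => by
    rw [hQ', IccExtend_of_mem hT.le _ ht]; rfl
  -- The rate is continued by its endpoint values and integrated from `P 0`.
  refine ⟨fun t => P 0 + ∫ s in (0 : ℝ)..t, Q' s, Q',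
    fun t => (hasDerivAt_primitive hQc t).const_add _, hQc, fun t ht => ?_, hQe⟩
  have := intervalIntegral.integral_eq_sub_of_hasDerivAt_of_le (a := 0) (b := t) (f := P)
    (f' := Q') ht.1 (hP.continuousOn.mono (Icc_subset_Icc_right ht.2)) (fun s hs => ?_)
    (hQc.intervalIntegrable _ _)
  · simp only; rw [this]; ring
  · have hs' : s ∈ Ioo 0 T := ⟨hs.1, hs.2.trans_le ht.2⟩
    have hn : Icc 0 T ∈ 𝓝 s := Icc_mem_nhds hs'.1 hs'.2
    rw [← hQe ⟨hs'.1.le, hs'.2.le⟩]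
    exact ((hP.differentiableOn (by simp) s ⟨hs'.1.le, hs'.2.le⟩).hasDerivWithinAt).hasDerivAt hn

end Decisions

/-! ### The wealth process and its expected utility -/

section Wealth

/-- The solution at time `t` of `dX = (r X + v P) dt + σ P dw`, `X 0 = x`, driven by the path
`w`. -/
noncomputable def wealthPath (r v σ x : ℝ) (P P' w : ℝ → ℝ) (t : ℝ) : ℝ :=
  Real.exp (r * t) * (x + v * (∫ s in (0 : ℝ)..t, Real.exp (-(r * s)) * P s) +
    σ * pathIntegral (fun s => Real.exp (-(r * s)) * P s)
      (fun s => Real.exp (-(r * s)) * (P' s - r * P s)) w t)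

variable {r v σ x T : ℝ} {P P' w : ℝ → ℝ}

lemma hasDerivAt_discounted (r : ℝ) (hP : ∀ t, HasDerivAt P (P' t) t) (t : ℝ) :
    HasDerivAt (fun s => Real.exp (-(r * s)) * P s) (Real.exp (-(r * t)) * (P' t - r * P t)) t := by
  have h0 : HasDerivAt (fun s => Real.exp (-(r * s))) (Real.exp (-(r * t)) * -r) t := by
    simpa using ((hasDerivAt_id t).const_mul r).fun_neg.exp
  exact (h0.fun_mul (hP t)).congr_deriv (by ring)

lemma continuous_wealthPath (hP : ∀ t, HasDerivAt P (P' t) t) (hP' : Continuous P')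
    (hw : Continuous w) : Continuous (wealthPath r v σ x P P' w) := by
  have hPc : Continuous P := continuous_iff_continuousAt.2 fun t => (hP t).continuousAt
  have h1 := continuous_pathIntegral (hasDerivAt_discounted r hP) (by fun_prop) hw
  have h2 := continuous_primitive (by fun_prop : Continuous fun s => Real.exp (-(r * s)) * P s)
  unfold wealthPath
  fun_prop

/-- Variation of constants. The path `w` need not be differentiable, but in `X - σ ∫ P dw` the terms
`σ P(t) w(t)` cancel, leaving the differentiable function `F`, to which the fundamental theorem of
calculus applies. -/
lemma wealthPath_eq (hP : ∀ t, HasDerivAt P (P' t) t) (hP' : Continuous P') (hw : Continuous w)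
    (t : ℝ) :
    wealthPath r v σ x P P' w t = x + (∫ s in (0 : ℝ)..t,
      (r * wealthPath r v σ x P P' w s + v * P s)) + σ * pathIntegral P P' w t := by
  have hPc : Continuous P := continuous_iff_continuousAt.2 fun t => (hP t).continuousAt
  have hXc := continuous_wealthPath (r := r) (v := v) (σ := σ) (x := x) hP hP' hw
  have hex : ∀ s, Real.exp (r * s) * Real.exp (-(r * s)) = 1 := fun s => by
    rw [← Real.exp_add]; simp
  set F : ℝ → ℝ := fun t => Real.exp (r * t) * (x + v * (∫ s in (0 : ℝ)..t,
      Real.exp (-(r * s)) * P s) + σ * (-(P 0 * w 0) - ∫ s in (0 : ℝ)..t,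
      Real.exp (-(r * s)) * (P' s - r * P s) * w s)) +
    σ * (P 0 * w 0 + ∫ s in (0 : ℝ)..t, P' s * w s) with hF
  have hFX : ∀ s, F s = wealthPath r v σ x P P' w s - σ * pathIntegral P P' w s := fun s => by
    simp only [hF, wealthPath, pathIntegral, mul_zero, neg_zero, Real.exp_zero, one_mul]
    linear_combination (- σ * P s * w s) * hex s
  have hFd : ∀ s, HasDerivAt F (r * wealthPath r v σ x P P' w s + v * P s) s := fun s => by
    have h1 := hasDerivAt_primitive (by fun_prop : Continuous fun s => Real.exp (-(r * s)) * P s) s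
    have h2 := hasDerivAt_primitive (by fun_prop : Continuous fun s =>
      Real.exp (-(r * s)) * (P' s - r * P s) * w s) s
    have h3 := hasDerivAt_primitive (by fun_prop : Continuous fun s => P' s * w s) s
    have h0 : HasDerivAt (fun s => Real.exp (r * s)) (Real.exp (r * s) * r) s := by
      simpa using ((hasDerivAt_id s).const_mul r).exp
    have h := (h0.fun_mul ((((h1.const_mul v).const_add x)).fun_add
      ((h2.const_sub (-(P 0 * w 0))).const_mul σ))).fun_add ((h3.const_add (P 0 * w 0)).const_mul σ)
    refine h.congr_deriv ?_
    simp only [wealthPath, pathIntegral, mul_zero, neg_zero, Real.exp_zero, one_mul]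
    linear_combination (v * P s - σ * P' s * w s) * hex s
  have h := intervalIntegral.integral_eq_sub_of_hasDerivAt (a := 0) (b := t) (fun s _ => hFd s)
    (Continuous.intervalIntegrable (by fun_prop) _ _)
  have hF0 : F 0 = x := by simp [hF]
  rw [h, hF0, hFX]
  ring

/-- Integrating factor: `exp (-r t) ∫₀ᵗ r D` has zero derivative. `D` is first extended continuously
to the line. -/
lemma eq_zero_of_eq_integral {D : ℝ → ℝ} (hT : 0 ≤ T) (hD : ContinuousOn D (Icc 0 T))
    (h : ∀ t ∈ Icc 0 T, D t = ∫ s in (0 : ℝ)..t, r * D s) : ∀ t ∈ Icc 0 T, D t = 0 := by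
  set d : ℝ → ℝ := IccExtend hT ((Icc 0 T).domRestrict D) with hd
  have hdc : Continuous d := (continuousOn_iff_continuous_domRestrict.1 hD).Icc_extend'
  have hdD : ∀ t ∈ Icc 0 T, d t = D t := fun t ht => by rw [hd, IccExtend_of_mem hT _ ht]; rfl
  have hI : ∀ t ∈ Icc 0 T, D t = ∫ s in (0 : ℝ)..t, r * d s := fun t ht => by
    rw [h t ht]
    refine intervalIntegral.integral_congr fun s hs => ?_
    rw [uIcc_of_le ht.1] at hs
    simp only [hdD s ⟨hs.1, hs.2.trans ht.2⟩]
  intro t ht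
  have hder : ∀ s ∈ uIcc 0 t, HasDerivAt
      (fun s => Real.exp (-(r * s)) * ∫ u in (0 : ℝ)..s, r * d u) 0 s := fun s hs => by
    rw [uIcc_of_le ht.1] at hs
    have hs' : s ∈ Icc 0 T := ⟨hs.1, hs.2.trans ht.2⟩
    have h0 := hasDerivAt_discounted r
      (fun s => hasDerivAt_primitive (by fun_prop : Continuous fun u => r * d u) s) s
    refine h0.congr_deriv ?_
    rw [← hI s hs', hdD s hs']
    ring
  have h1 := intervalIntegral.integral_eq_sub_of_hasDerivAt hder (by simp)
  simp only [intervalIntegral.integral_zero, intervalIntegral.integral_same, mul_zero,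
    sub_zero] at h1
  rw [hI t ht]
  exact (mul_eq_zero.1 h1.symm).resolve_left (Real.exp_pos _).ne'

variable {Ω : Type*} [MeasurableSpace Ω] {μ : Measure Ω} {W : ℝ≥0 → Ω → ℝ}

lemma IsWealth.congr {Q : ℝ → ℝ} {X : ℝ → Ω → ℝ} (h : IsWealth r v σ T x μ W P X)
    (hPQ : EqOn P Q (Icc 0 T)) : IsWealth r v σ T x μ W Q X := by
  obtain ⟨hc, M, hM, hX⟩ := h
  refine ⟨hc, M, fun t ht => ?_, fun t ht => ?_⟩
  · have hsum : (fun (n : ℕ) (ω : Ω) => ∑ k ∈ Finset.range n, P (t * (k : ℝ) / n) *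
        (W (Real.toNNReal (t * ((k : ℝ) + 1) / n)) ω - W (Real.toNNReal (t * (k : ℝ) / n)) ω)) =
        fun (n : ℕ) (ω : Ω) => ∑ k ∈ Finset.range n, Q (t * (k : ℝ) / n) *
        (W (Real.toNNReal (t * ((k : ℝ) + 1) / n)) ω - W (Real.toNNReal (t * (k : ℝ) / n)) ω) := by
      funext n ω
      refine Finset.sum_congr rfl fun k hk => ?_
      have hk' : k < n := Finset.mem_range.1 hk
      have hn : (0 : ℝ) < n := by exact_mod_cast (Nat.zero_le k).trans_lt hk'
      have hkn : (k : ℝ) ≤ n := by exact_mod_cast hk'.le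
      have ht0 := ht.1
      rw [hPQ]
      refine ⟨by positivity, le_trans ?_ ht.2⟩
      rw [div_le_iff₀ hn]
      gcongr
    have := hM t ht
    rwa [hsum] at this
  · filter_upwards [hX t ht] with ω hω
    rw [hω]
    congr 2
    refine intervalIntegral.integral_congr fun s hs => ?_
    rw [uIcc_of_le ht.1] at hs
    simp only [hPQ ⟨hs.1, hs.2.trans ht.2⟩]

lemma isWealth_wealthPath [IsProbabilityMeasure μ] (hW : IsBrownianReal W μ)
    (hP : ∀ t, HasDerivAt P (P' t) t) (hP' : Continuous P') :
    IsWealth r v σ T x μ W P (fun t ω => wealthPath r v σ x P P' (fun s => W s.toNNReal ω) t) := by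
  have hc : ∀ᵐ ω ∂μ, Continuous fun s : ℝ => W s.toNNReal ω := by
    filter_upwards [hW.cont] with ω hω using hω.comp continuous_real_toNNReal
  refine ⟨?_, _, isItoIntegral_pathIntegral hW hP hP', fun t ht => ?_⟩
  · filter_upwards [hc] with ω hω using (continuous_wealthPath hP hP' hω).continuousOn
  · filter_upwards [hc] with ω hω using wealthPath_eq hP hP' hω t

/-- Pathwise uniqueness of the wealth process. -/
lemma IsWealth.ae_eq_wealthPath [IsProbabilityMeasure μ] (hW : IsBrownianReal W μ) (hT : 0 ≤ T)
    (hP : ∀ t, HasDerivAt P (P' t) t) (hP' : Continuous P') {X : ℝ → Ω → ℝ}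
    (h : IsWealth r v σ T x μ W P X) :
    ∀ᵐ ω ∂μ, X T ω = wealthPath r v σ x P P' (fun s => W s.toNNReal ω) T := by
  have hPc : Continuous P := continuous_iff_continuousAt.2 fun t => (hP t).continuousAt
  have hWc : ∀ᵐ ω ∂μ, Continuous fun s : ℝ => W s.toNNReal ω := by
    filter_upwards [hW.cont] with ω hω using hω.comp continuous_real_toNNReal
  obtain ⟨hXc, M, hM, hX⟩ := h
  rcases hT.eq_or_lt with rfl | hT'
  -- For `T = 0` the interval `(0, T)` is empty and the density argument below says nothing.
  · have h0 := tendstoInMeasure_ae_unique (hM 0 ⟨le_rfl, le_rfl⟩)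
      (isItoIntegral_pathIntegral hW hP hP' (T := 0) 0 ⟨le_rfl, le_rfl⟩)
    filter_upwards [h0, hX 0 ⟨le_rfl, le_rfl⟩, hWc] with ω h1 h2 h3
    rw [h2, h1, wealthPath_eq hP hP' h3]
    simp
  -- The exceptional null set depends on the time. Rational times yield a single null set, and
  -- continuity extends the equation to all of `[0, T]`.
  have hrat : ∀ᵐ ω ∂μ, ∀ q : ℚ, (q : ℝ) ∈ Icc 0 T → X q ω = x + (∫ s in (0 : ℝ)..q,
      (r * X s ω + v * P s)) + σ * pathIntegral P P' (fun s => W s.toNNReal ω) q := by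
    rw [ae_all_iff]
    intro q
    by_cases hq : (q : ℝ) ∈ Icc 0 T
    · have h0 := tendstoInMeasure_ae_unique (hM q hq)
        (isItoIntegral_pathIntegral hW hP hP' (T := T) q hq)
      filter_upwards [h0, hX q hq] with ω h1 h2 _
      rw [h2, h1]
    · exact Eventually.of_forall fun ω h => absurd h hq
  filter_upwards [hrat, hXc, hWc] with ω hω hc hw
  set d : ℝ → ℝ := IccExtend hT ((Icc 0 T).domRestrict fun t => X t ω) with hd
  have hdc : Continuous d := (continuousOn_iff_continuous_domRestrict.1 hc).Icc_extend'
  have hdX : ∀ t ∈ Icc 0 T, d t = X t ω := fun t ht => by rw [hd, IccExtend_of_mem hT _ ht]; rfl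
  have hint : ∀ t ∈ Icc 0 T, ∫ s in (0 : ℝ)..t, (r * X s ω + v * P s) =
      ∫ s in (0 : ℝ)..t, (r * d s + v * P s) := fun t ht => by
    refine intervalIntegral.integral_congr fun s hs => ?_
    rw [uIcc_of_le ht.1] at hs
    simp only [hdX s ⟨hs.1, hs.2.trans ht.2⟩]
  have hmc := continuous_pathIntegral hP hP' hw
  have hic := continuous_primitive (by fun_prop : Continuous fun s => r * d s + v * P s)
  have hsub : closure (Ioo 0 T ∩ range ((↑) : ℚ → ℝ)) ⊆ {t | d t = x + (∫ s in (0 : ℝ)..t,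
      (r * d s + v * P s)) + σ * pathIntegral P P' (fun s => W s.toNNReal ω) t} := by
    refine closure_minimal ?_ (isClosed_eq hdc (by fun_prop))
    rintro _ ⟨ht, q, rfl⟩
    have hq : (q : ℝ) ∈ Icc 0 T := Ioo_subset_Icc_self ht
    rw [Set.mem_ofPred_eq, hdX _ hq, ← hint _ hq]
    exact hω q hq
  have hall : ∀ t ∈ Icc 0 T, d t = x + (∫ s in (0 : ℝ)..t,
      (r * d s + v * P s)) + σ * pathIntegral P P' (fun s => W s.toNNReal ω) t := fun t ht => by
    refine hsub ?_
    have h1 : Icc 0 T = closure (Ioo 0 T) := (closure_Ioo hT'.ne).symm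
    rw [h1] at ht
    exact closure_minimal
      (Dense.open_subset_closure_inter Rat.denseRange_cast isOpen_Ioo) isClosed_closure ht
  have hxc := continuous_wealthPath (r := r) (v := v) (σ := σ) (x := x) hP hP' hw
  have hzero := eq_zero_of_eq_integral (r := r) (T := T) hT
    (D := fun t => d t - wealthPath r v σ x P P' (fun s => W s.toNNReal ω) t)
    (by fun_prop) (fun t ht => ?_) T ⟨hT, le_rfl⟩
  · rw [← hdX T ⟨hT, le_rfl⟩]
    linarith
  · rw [hall t ht, wealthPath_eq hP hP' hw t, add_sub_add_right_eq_sub, add_sub_add_left_eq_sub,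
      ← intervalIntegral.integral_sub]
    · congr 1; ext s; ring
    all_goals exact Continuous.intervalIntegrable (by fun_prop) _ _

/-- The exponent `G` for which the expected utility of the terminal wealth is
`-(1 / α) exp G`. -/
noncomputable def utilityExponent (r v σ T x α : ℝ) (P : ℝ → ℝ) : ℝ :=
  -α * (Real.exp (r * T) * (x + v * ∫ s in (0 : ℝ)..T, Real.exp (-(r * s)) * P s)) +
    (α * (Real.exp (r * T) * σ)) ^ 2 * (∫ s in (0 : ℝ)..T, (Real.exp (-(r * s)) * P s) ^ 2) / 2

/-- Terminal wealth is almost surely an affine function of the centred Gaussian `N`, so both claims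
come from the Gaussian moment generating function. -/
lemma IsWealth.integrable_utility_and_integral_eq [IsProbabilityMeasure μ]
    (hW : IsBrownianReal W μ) (hT : 0 ≤ T) (hP : ∀ t, HasDerivAt P (P' t) t) (hP' : Continuous P')
    {X : ℝ → Ω → ℝ} (h : IsWealth r v σ T x μ W P X) (α : ℝ) :
    Integrable (fun ω => utility α (X T ω)) μ ∧
      ∫ ω, utility α (X T ω) ∂μ = -(1 / α) * Real.exp (utilityExponent r v σ T x α P) := by
  have hPc : Continuous P := continuous_iff_continuousAt.2 fun t => (hP t).continuousAt
  set N : Ω → ℝ := fun ω => pathIntegral (fun s => Real.exp (-(r * s)) * P s)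
      (fun s => Real.exp (-(r * s)) * (P' s - r * P s)) (fun s => W s.toNNReal ω) T with hN
  have hlaw := hasLaw_pathIntegral hW (hasDerivAt_discounted r hP) (by fun_prop) hT
  set V := ∫ s in (0 : ℝ)..T, (Real.exp (-(r * s)) * P s) ^ 2 with hV
  have hV0 : 0 ≤ V := integral_sq_nonneg hT _
  set m := Real.exp (r * T) * (x + v * ∫ s in (0 : ℝ)..T, Real.exp (-(r * s)) * P s) with hm
  set β := -α * (Real.exp (r * T) * σ) with hβ
  have hae : (fun ω => utility α (X T ω)) =ᵐ[μ]
      fun ω => -(1 / α) * Real.exp (-α * m) * Real.exp (β * N ω) := by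
    filter_upwards [h.ae_eq_wealthPath hW hT hP hP'] with ω hω
    rw [hω, utility, mul_assoc, ← Real.exp_add]
    congr 2
    simp only [wealthPath, hm, hβ, hN]
    ring
  have hint : Integrable (fun ω => Real.exp (β * N ω)) μ := by
    have := integrable_exp_mul_gaussianReal (μ := 0) (v := V.toNNReal) β
    rw [← hlaw.map_eq] at this
    exact this.comp_aemeasurable hlaw.aemeasurable
  refine ⟨(hint.const_mul _).congr hae.symm, ?_⟩
  rw [integral_congr_ae hae, integral_const_mul]
  have := mgf_gaussianReal hlaw.map_eq β
  rw [mgf, Real.coe_toNNReal _ hV0] at this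
  rw [this, mul_assoc, ← Real.exp_add, utilityExponent, ← hm, ← hV]
  congr 2
  rw [hβ]
  ring

end Wealth

/-! ### Estimates for the quadratic functional -/

section Quadratic

variable {T : ℝ} {a k P h : ℝ → ℝ}

lemma integral_quadratic_add (ha : Continuous a) (hk : Continuous k) (hP : Continuous P)
    (hh : Continuous h) (T : ℝ) :
    ∫ s in (0 : ℝ)..T, (a s * (P s + h s) ^ 2 / 2 - k s * (P s + h s)) =
      (∫ s in (0 : ℝ)..T, (a s * P s ^ 2 / 2 - k s * P s)) +
      (∫ s in (0 : ℝ)..T, (a s * P s - k s) * h s) + ∫ s in (0 : ℝ)..T, a s * h s ^ 2 / 2 := by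
  rw [← intervalIntegral.integral_add, ← intervalIntegral.integral_add]
  · congr 1; ext s; ring
  all_goals exact Continuous.intervalIntegrable (by fun_prop) _ _

/-- Cauchy–Schwarz, from expanding the integral over `[0, t]` of the squared deviation of `f` from
its mean. -/
lemma sq_integral_le {f : ℝ → ℝ} (hf : Continuous f) {t : ℝ} (ht : t ∈ Icc 0 T) :
    (∫ s in (0 : ℝ)..t, f s) ^ 2 ≤ T * ∫ s in (0 : ℝ)..T, f s ^ 2 := by
  have hsq : Continuous fun s => f s ^ 2 := by fun_prop
  have h2 : ∫ s in (0 : ℝ)..t, f s ^ 2 ≤ ∫ s in (0 : ℝ)..T, f s ^ 2 :=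
    intervalIntegral.integral_mono_interval le_rfl ht.1 ht.2
      (Eventually.of_forall fun s => sq_nonneg (f s)) (hsq.intervalIntegrable _ _)
  have hnn := integral_sq_nonneg ht.1 f
  rcases ht.1.eq_or_lt with h0 | h0
  · subst h0
    rw [intervalIntegral.integral_same]
    have := integral_sq_nonneg ht.2 f
    simpa using mul_nonneg ht.2 this
  set I := ∫ s in (0 : ℝ)..t, f s with hI
  have h1 := integral_sq_nonneg ht.1 fun s => f s - I / t
  have h3 : ∫ s in (0 : ℝ)..t, (f s - I / t) ^ 2 =
      (∫ s in (0 : ℝ)..t, f s ^ 2) - 2 * (I / t) * I + (I / t) ^ 2 * t := by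
    have : (fun s => (f s - I / t) ^ 2) = fun s => f s ^ 2 - 2 * (I / t) * f s + (I / t) ^ 2 := by
      ext s; ring
    rw [this, intervalIntegral.integral_add, intervalIntegral.integral_sub,
      intervalIntegral.integral_const_mul, intervalIntegral.integral_const]
    · simp only [smul_eq_mul, sub_zero, ← hI]; ring
    all_goals exact Continuous.intervalIntegrable (by fun_prop) _ _
  have h4 : (I / t) * t = I := div_mul_cancel₀ _ h0.ne'
  have h5 : I ^ 2 ≤ t * ∫ s in (0 : ℝ)..t, f s ^ 2 := by
    rw [h3] at h1
    have := mul_nonneg h0.le h1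
    have e : t * ((∫ s in (0 : ℝ)..t, f s ^ 2) - 2 * (I / t) * I + (I / t) ^ 2 * t) =
        t * (∫ s in (0 : ℝ)..t, f s ^ 2) - I ^ 2 := by
      linear_combination (-2 * I + (I / t) * t + I) * h4
    linarith
  calc I ^ 2 ≤ t * ∫ s in (0 : ℝ)..t, f s ^ 2 := h5
    _ ≤ T * ∫ s in (0 : ℝ)..T, f s ^ 2 := mul_le_mul ht.2 h2 hnn (ht.1.trans ht.2)

/-- If `w` is nearly constant and the quadratic functional at `w` is nonpositive, while its linear
part annihilates constants, then `w` is small. -/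
lemma sq_le_of_quadratic_nonpos {ℓ w w' : ℝ → ℝ} {a₀ M η : ℝ} (hT : 0 < T) (ha : Continuous a)
    (ha₀ : 0 < a₀) (hlow : ∀ s ∈ Icc 0 T, a₀ ≤ a s) (hℓ : Continuous ℓ)
    (hM : ∀ s ∈ Icc 0 T, |ℓ s| ≤ M) (hℓ0 : ∫ s in (0 : ℝ)..T, ℓ s = 0)
    (hw : ∀ t, HasDerivAt w (w' t) t) (hw' : Continuous w') (hη : 0 ≤ η)
    (hosc : T * ∫ s in (0 : ℝ)..T, w' s ^ 2 ≤ η ^ 2)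
    (hq : (∫ s in (0 : ℝ)..T, ℓ s * w s) + ∫ s in (0 : ℝ)..T, a s * w s ^ 2 / 2 ≤ 0) :
    ∀ t ∈ Icc 0 T, w t ^ 2 ≤ 4 * M * η / a₀ + 8 * η ^ 2 := by
  have hwc : Continuous w := continuous_iff_continuousAt.2 fun t => (hw t).continuousAt
  have he : ∀ t ∈ Icc 0 T, |w t - w 0| ≤ η := fun t ht => by
    have h1 := sq_integral_le hw' ht
    rw [intervalIntegral.integral_eq_sub_of_hasDerivAt (fun s _ => hw s)
      (hw'.intervalIntegrable _ _)] at h1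
    exact abs_le_of_sq_le_sq (h1.trans hosc) hη
  have hM0 : 0 ≤ M := (abs_nonneg _).trans (hM 0 ⟨le_rfl, hT.le⟩)
  -- As `∫ ℓ = 0`, only the oscillation `w - w 0` contributes to the linear term.
  have hlin : -(M * η * T) ≤ ∫ s in (0 : ℝ)..T, ℓ s * w s := by
    have h1 : ∫ s in (0 : ℝ)..T, ℓ s * w s = ∫ s in (0 : ℝ)..T, ℓ s * (w s - w 0) := by
      have : (fun s => ℓ s * (w s - w 0)) = fun s => ℓ s * w s - ℓ s * w 0 := by ext s; ring
      rw [this, intervalIntegral.integral_sub, intervalIntegral.integral_mul_const, hℓ0]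
      · ring
      all_goals exact Continuous.intervalIntegrable (by fun_prop) _ _
    have h2 : ∫ s in (0 : ℝ)..T, -(M * η) ≤ ∫ s in (0 : ℝ)..T, ℓ s * (w s - w 0) := by
      refine intervalIntegral.integral_mono_on hT.le (by simp)
        (Continuous.intervalIntegrable (by fun_prop) _ _) fun s hs => ?_
      have h3 : |ℓ s * (w s - w 0)| ≤ M * η := by
        rw [abs_mul]
        exact mul_le_mul (hM s hs) (he s hs) (abs_nonneg _) hM0
      linarith [neg_abs_le (ℓ s * (w s - w 0))]
    rw [intervalIntegral.integral_const, smul_eq_mul] at h2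
    rw [h1]
    linarith
  intro t ht
  -- From `w(t)² ≤ 2 w(s)² + 2 (2η)²`, and hence `w(s)² ≥ w(t)² / 2 - 4 η²`.
  have hint : ∫ s in (0 : ℝ)..T, (a₀ / 4 * w t ^ 2 - 2 * a₀ * η ^ 2) ≤
      ∫ s in (0 : ℝ)..T, a s * w s ^ 2 / 2 := by
    refine intervalIntegral.integral_mono_on hT.le (by simp)
      (Continuous.intervalIntegrable (by fun_prop) _ _) fun s hs => ?_
    have h1 := abs_le.1 (he s hs)
    have h2 := abs_le.1 (he t ht)
    have h3 : (w t - w s) ^ 2 ≤ (2 * η) ^ 2 := sq_le_sq' (by linarith) (by linarith)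
    have h4 := mul_le_mul_of_nonneg_right (hlow s hs) (sq_nonneg (w s))
    have h5 : w t ^ 2 ≤ 2 * w s ^ 2 + 8 * η ^ 2 := by
      nlinarith [sq_nonneg (w t - 2 * w s)]
    nlinarith
  rw [intervalIntegral.integral_const, smul_eq_mul, sub_zero] at hint
  have h6 : T * (a₀ / 4 * w t ^ 2 - 2 * a₀ * η ^ 2) ≤ T * (M * η) := by linarith
  have h7 := le_of_mul_le_mul_left h6 hT
  have h8 : a₀ * w t ^ 2 ≤ a₀ * (4 * M * η / a₀ + 8 * η ^ 2) := by
    rw [mul_add, mul_div_cancel₀ _ ha₀.ne']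
    linarith
  exact le_of_mul_le_mul_left h8 ha₀

end Quadratic

/-! ### The deterministic objective -/

section Objective

variable {r v σ T x₁ α₁ α₂ θ : ℝ}

lemma hasDerivAt_rationalDecision (r v σ T α t : ℝ) :
    HasDerivAt (rationalDecision r v σ T α) (r * rationalDecision r v σ T α t) t := by
  have h : HasDerivAt (fun t => Real.exp (r * (t - T))) (Real.exp (r * (t - T)) * r) t := by
    simpa using (((hasDerivAt_id t).sub_const T).const_mul r).exp
  exact (h.const_mul (v / (α * σ ^ 2))).congr_deriv (by unfold rationalDecision; ring)

@[fun_prop]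
lemma continuous_rationalDecision (r v σ T α : ℝ) : Continuous (rationalDecision r v σ T α) :=
  continuous_iff_continuousAt.2 fun t => (hasDerivAt_rationalDecision r v σ T α t).continuousAt

lemma isFeasible_iff {P : ℝ → ℝ} :
    IsFeasible r v σ T α₂ P ↔ IsDecision T P ∧
      rate T P 0 = r * rationalDecision r v σ T α₂ 0 ∧
      rate T P T = r * rationalDecision r v σ T α₂ T := by
  have h0 : r * v / (α₂ * σ ^ 2) * Real.exp (-(r * T)) = r * rationalDecision r v σ T α₂ 0 := by
    unfold rationalDecision; rw [show r * (0 - T) = -(r * T) by ring]; ring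
  have h1 : r * v / (α₂ * σ ^ 2) = r * rationalDecision r v σ T α₂ T := by
    unfold rationalDecision; simp; ring
  rw [IsFeasible, h0, ← h1]

lemma integralDisparity_eq (hT : 0 < T) {P Q' : ℝ → ℝ} (h : EqOn (rate T P) Q' (Icc 0 T)) :
    integralDisparity T P (fun t => rationalDecision r v σ T α₂ t) =
      1 / 2 * ∫ t in (0 : ℝ)..T, (Q' t - r * rationalDecision r v σ T α₂ t) ^ 2 := by
  unfold integralDisparity
  congr 1
  refine intervalIntegral.integral_congr fun t ht => ?_
  rw [uIcc_of_le hT.le] at ht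
  simp only [h ht, rate_eq_of_hasDerivAt hT (hasDerivAt_rationalDecision r v σ T α₂) ht]

/-- The curvature of the exponent of the expected utility. -/
noncomputable def curvature (r σ T α s : ℝ) : ℝ := α * σ ^ 2 * Real.exp (r * (T - s)) ^ 2

/-- The slope of the exponent of the expected utility. -/
noncomputable def slope (r v T s : ℝ) : ℝ := v * Real.exp (r * (T - s))

@[fun_prop]
lemma continuous_curvature (r σ T α : ℝ) : Continuous (curvature r σ T α) := by
  unfold curvature; fun_prop

@[fun_prop]
lemma continuous_slope (r v T : ℝ) : Continuous (slope r v T) := by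
  unfold slope; fun_prop

lemma utilityExponent_eq (r v σ T x α : ℝ) {P : ℝ → ℝ} (hP : Continuous P) :
    utilityExponent r v σ T x α P = -α * (Real.exp (r * T) * x) +
      α * ∫ s in (0 : ℝ)..T, (curvature r σ T α s * P s ^ 2 / 2 - slope r v T s * P s) := by
  have hex : ∀ s, Real.exp (r * (T - s)) = Real.exp (r * T) * Real.exp (-(r * s)) := fun s => by
    rw [← Real.exp_add]; ring_nf
  have h : (fun s => curvature r σ T α s * P s ^ 2 / 2 - slope r v T s * P s) = fun s =>
      α * σ ^ 2 * Real.exp (r * T) ^ 2 / 2 * (Real.exp (-(r * s)) * P s) ^ 2 -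
        v * Real.exp (r * T) * (Real.exp (-(r * s)) * P s) := by
    ext s
    unfold curvature slope
    rw [hex]; ring
  rw [h, intervalIntegral.integral_sub, intervalIntegral.integral_const_mul,
    intervalIntegral.integral_const_mul, utilityExponent]
  · ring
  all_goals exact Continuous.intervalIntegrable (by fun_prop) _ _

/-- The exponent is quadratic, so its second-order expansion is exact. -/
lemma utilityExponent_add (r v σ T x α : ℝ) {P h : ℝ → ℝ} (hP : Continuous P)
    (hh : Continuous h) :
    utilityExponent r v σ T x α (fun s => P s + h s) = utilityExponent r v σ T x α P +
      α * ((∫ s in (0 : ℝ)..T, (curvature r σ T α s * P s - slope r v T s) * h s) +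
        ∫ s in (0 : ℝ)..T, curvature r σ T α s * h s ^ 2 / 2) := by
  rw [utilityExponent_eq r v σ T x α (P := fun s => P s + h s) (hP.add hh), utilityExponent_eq r v σ T x α hP,
    integral_quadratic_add (continuous_curvature r σ T α) (continuous_slope r v T) hP hh]
  ring

variable {Ω : Type*} [MeasurableSpace Ω] {μ : Measure Ω} {W : ℝ≥0 → Ω → ℝ}

/-- The objective as a deterministic functional of the decision. -/
lemma objective_eq [IsProbabilityMeasure μ] (hW : IsBrownianReal W μ) (hT : 0 < T)
    {P Q Q' : ℝ → ℝ} {X : ℝ → Ω → ℝ} (hQ : ∀ t, HasDerivAt Q (Q' t) t) (hQ' : Continuous Q')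
    (hPQ : EqOn P Q (Icc 0 T)) (hr : EqOn (rate T P) Q' (Icc 0 T))
    (hX : IsWealth r v σ T x₁ μ W P X) :
    objective r v σ T α₁ α₂ θ μ P X =
      -(1 / α₁) * Real.exp (utilityExponent r v σ T x₁ α₁ Q) -
        θ * (1 / 2 * ∫ t in (0 : ℝ)..T, (Q' t - r * rationalDecision r v σ T α₂ t) ^ 2) := by
  rw [objective, integralDisparity_eq hT hr,
    ((hX.congr hPQ).integrable_utility_and_integral_eq hW hT.le hQ hQ' α₁).2]

/-! ### Existence of an optimal decision -/

/-- The retail investor's problem has a solution. -/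
theorem exists_isOptimal [IsProbabilityMeasure μ] (hW : IsBrownianReal W μ) (hσ : 0 < σ)
    (hT : 0 < T) (hα₁ : 0 < α₁) (hθ : 0 < θ) :
    ∃ P : ℝ → ℝ, IsOptimal r v σ T x₁ α₁ α₂ θ μ W P := by
  set p := rationalDecision r v σ T α₂ with hp
  set A := curvature r σ T α₁ with hA
  set k := slope r v T with hk
  set G := utilityExponent r v σ T x₁ α₁ with hG
  have hpc : Continuous p := continuous_rationalDecision r v σ T α₂
  have hAc : Continuous A := continuous_curvature r σ T α₁
  have hkc : Continuous k := continuous_slope r v T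
  -- The Euler–Lagrange equation for `P = p + R`. Factoring `exp G(p)` out of `exp G(P)` gives the
  -- constant `c`, and what remains is the exponential in the coefficient.
  obtain ⟨R, S, ε, hSc, hRS, hSd, hS0, hST, hε⟩ := exists_neumann_solution (T := T) (κ := α₁)
    (c := Real.exp (G p) / θ) (a := A) (b := fun s => k s - A s * p s) hT hα₁ (by positivity)
    hAc (by fun_prop) (fun t => by simp only [hA, curvature]; positivity)
  have hRc : Continuous R := continuous_iff_continuousAt.2 fun t => (hRS t).continuousAt
  have hPd : ∀ t, HasDerivAt (fun s => p s + R s) (r * p t + S t) t := fun t =>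
    (hasDerivAt_rationalDecision r v σ T α₂ t).fun_add (hRS t)
  have hPc' : Continuous fun t => r * p t + S t := by fun_prop
  have hGP : θ * ε = Real.exp (G fun s => p s + R s) := by
    rw [hε, hG, utilityExponent_add r v σ T x₁ α₁ hpc hRc, Real.exp_add, ← mul_assoc,
      mul_div_cancel₀ _ hθ.ne']
    congr 3
    rw [← intervalIntegral.integral_add]
    · congr 1; ext s; ring
    all_goals exact Continuous.intervalIntegrable (by fun_prop) _ _
  have hX := isWealth_wealthPath (r := r) (v := v) (σ := σ) (x := x₁) (T := T) hW hPd hPc'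
  have hrP : EqOn (rate T fun s => p s + R s) (fun t => r * p t + S t) (Icc 0 T) :=
    fun t ht => rate_eq_of_hasDerivAt hT hPd ht
  refine ⟨fun s => p s + R s, isFeasible_iff.2 ⟨isDecision_of_hasDerivAt hPd hPc', ?_, ?_⟩,
    _, hX, (hX.integrable_utility_and_integral_eq hW hT.le hPd hPc' α₁).1, ?_⟩
  · simpa only [hS0, add_zero] using hrP ⟨le_rfl, hT.le⟩
  · simpa only [hST, add_zero] using hrP ⟨hT.le, le_rfl⟩
  intro Q₀ Y hQ₀ hY _
  obtain ⟨Q, Q', hQ, hQ', hQe, hQr⟩ := hQ₀.1.exists_extension hT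
  have hQc : Continuous Q := continuous_iff_continuousAt.2 fun t => (hQ t).continuousAt
  rw [objective_eq hW hT hQ hQ' hQe hQr hY, objective_eq hW hT hPd hPc' (fun _ _ => rfl) hrP hX]
  have hhd : ∀ t, HasDerivAt (fun s => Q s - (p s + R s)) (Q' t - (r * p t + S t)) t :=
    fun t => (hQ t).fun_sub (hPd t)
  set L := ∫ s in (0 : ℝ)..T, (A s * (p s + R s) - k s) * (Q s - (p s + R s)) with hL
  have hGQ : G (fun s => p s + R s) + α₁ * L ≤ G Q := by
    have h1 := utilityExponent_add r v σ T x₁ α₁ (P := fun s => p s + R s)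
      (h := fun s => Q s - (p s + R s)) (by fun_prop) (by fun_prop)
    simp only [add_sub_cancel] at h1
    have h2 : 0 ≤ ∫ s in (0 : ℝ)..T, A s * (Q s - (p s + R s)) ^ 2 / 2 :=
      intervalIntegral.integral_nonneg hT.le fun s _ => by
        simp only [hA, curvature]; positivity
    have h3 := mul_nonneg hα₁.le h2
    change G Q = G _ + α₁ * (L + _) at h1
    rw [h1]
    linarith
  -- Tangent-line inequality for `exp` at `G(P)`; `L` is the first variation in the direction `Q -
  -- P`.
  have hexp : Real.exp (G fun s => p s + R s) * (1 + α₁ * L) ≤ Real.exp (G Q) := by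
    calc _ ≤ Real.exp (G fun s => p s + R s) * Real.exp (α₁ * L) := by
          gcongr
          linarith [Real.add_one_le_exp (α₁ * L)]
      _ = Real.exp ((G fun s => p s + R s) + α₁ * L) := (Real.exp_add _ _).symm
      _ ≤ Real.exp (G Q) := Real.exp_le_exp.2 hGQ
  -- The boundary terms vanish because `S` is zero at both ends.
  have hparts : ∫ s in (0 : ℝ)..T, S s * (Q' s - (r * p s + S s)) = -(ε * L) := by
    have h1 := intervalIntegral.integral_mul_deriv_eq_deriv_mul (a := 0) (b := T) (u := S)
      (v := fun s => Q s - (p s + R s)) (u' := fun t => ε * (A t * R t - (k t - A t * p t)))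
      (v' := fun t => Q' t - (r * p t + S t))
      (fun t ht => hSd t (by rwa [uIcc_of_le hT.le] at ht)) (fun t _ => hhd t)
      (Continuous.intervalIntegrable (by fun_prop) _ _)
      (Continuous.intervalIntegrable (by fun_prop) _ _)
    rw [h1, hS0, hST, hL, ← intervalIntegral.integral_const_mul]
    simp only [zero_mul, sub_zero, zero_sub]
    congr 2; ext s; ring
  have hD : (∫ t in (0 : ℝ)..T, (r * p t + S t - r * p t) ^ 2) - 2 * (ε * L) ≤
      ∫ t in (0 : ℝ)..T, (Q' t - r * p t) ^ 2 := by
    have h1 : (∫ t in (0 : ℝ)..T, (Q' t - r * p t) ^ 2) =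
        (∫ t in (0 : ℝ)..T, (r * p t + S t - r * p t) ^ 2) +
          2 * (∫ s in (0 : ℝ)..T, S s * (Q' s - (r * p s + S s))) +
          ∫ s in (0 : ℝ)..T, (Q' s - (r * p s + S s)) ^ 2 := by
      rw [← intervalIntegral.integral_const_mul, ← intervalIntegral.integral_add,
        ← intervalIntegral.integral_add]
      · congr 1; ext s; ring
      all_goals exact Continuous.intervalIntegrable (by fun_prop) _ _
    have h2 := integral_sq_nonneg hT.le fun s => Q' s - (r * p s + S s)
    rw [h1, hparts]
    linarith
  -- By `hGP`, the first variations `exp(G(P)) L` of the utility term and `-θ ε L` of the penalty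
  -- cancel.
  have e1 := mul_le_mul_of_nonneg_left hexp (by positivity : 0 ≤ 1 / α₁)
  have e2 := mul_le_mul_of_nonneg_left hD hθ.le
  have e3 : 1 / α₁ * (Real.exp (G fun s => p s + R s) * (1 + α₁ * L)) =
      1 / α₁ * Real.exp (G fun s => p s + R s) + θ * ε * L := by
    rw [hGP]; field_simp
  rw [e3] at e1
  linarith

/-! ### The limit of strong imitation -/

/-- The constant to which the optimal deviation from the expert's decision converges. -/
noncomputable def asymptoticShift (r v σ T α₁ α₂ : ℝ) : ℝ :=
  v / σ ^ 2 * (1 / α₁ - 1 / α₂) * (2 / (Real.exp (r * T) + 1))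

lemma integral_exp_discount (hr : 0 < r) (T : ℝ) :
    ∫ s in (0 : ℝ)..T, Real.exp (r * (T - s)) = (Real.exp (r * T) - 1) / r := by
  have h : ∀ s ∈ uIcc 0 T, HasDerivAt (fun s => -(Real.exp (r * (T - s)) / r))
      (Real.exp (r * (T - s))) s := fun s _ => by
    have h1 : HasDerivAt (fun s => Real.exp (r * (T - s))) (Real.exp (r * (T - s)) * -r) s := by
      simpa using (((hasDerivAt_id s).const_sub T).const_mul r).exp
    refine (h1.div_const r).fun_neg.congr_deriv ?_
    field_simp
  rw [intervalIntegral.integral_eq_sub_of_hasDerivAt h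
    (Continuous.intervalIntegrable (by fun_prop) _ _)]
  simp
  ring

/-- Stationarity of `G` along constant shifts of the expert's decision, which determines the
constant. The factor `2 / (exp (r T) + 1)` is the ratio of `∫ exp (r (T - s))` to `∫ exp (2 r (T -
s))`. -/
lemma integral_marginal_asymptoticShift (hr : 0 < r) (hσ : 0 < σ) (hα₁ : 0 < α₁) (hα₂ : 0 < α₂) :
    ∫ s in (0 : ℝ)..T, (curvature r σ T α₁ s *
      (rationalDecision r v σ T α₂ s + asymptoticShift r v σ T α₁ α₂) - slope r v T s) = 0 := by
  set c := asymptoticShift r v σ T α₁ α₂ with hc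
  have h : (fun s => curvature r σ T α₁ s * (rationalDecision r v σ T α₂ s + c) - slope r v T s) =
      fun s => c * α₁ * σ ^ 2 * Real.exp (2 * r * (T - s)) -
        v * (1 - α₁ / α₂) * Real.exp (r * (T - s)) := by
    ext s
    have e1 : Real.exp (r * (T - s)) * Real.exp (r * (s - T)) = 1 := by
      rw [← Real.exp_add]; ring_nf; simp
    have e2 : Real.exp (2 * r * (T - s)) = Real.exp (r * (T - s)) ^ 2 := by
      rw [← Real.exp_nat_mul]; ring_nf
    have e3 : α₁ * σ ^ 2 * (v / (α₂ * σ ^ 2)) = v * (α₁ / α₂) := by field_simp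
    rw [e2]
    unfold curvature slope rationalDecision
    linear_combination Real.exp (r * (T - s)) ^ 2 * Real.exp (r * (s - T)) * e3 +
      v * (α₁ / α₂) * Real.exp (r * (T - s)) * e1
  rw [h, intervalIntegral.integral_sub, intervalIntegral.integral_const_mul,
    intervalIntegral.integral_const_mul, integral_exp_discount hr,
    integral_exp_discount (by linarith : 0 < 2 * r)]
  · have e2 : Real.exp (2 * r * T) = Real.exp (r * T) ^ 2 := by
      rw [← Real.exp_nat_mul]; ring_nf
    rw [e2, hc, asymptoticShift]
    have : 0 < Real.exp (r * T) := Real.exp_pos _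
    field_simp
    ring
  all_goals exact Continuous.intervalIntegrable (by fun_prop) _ _

/-- Optimal decisions converge to the expert's decision shifted by a constant. -/
theorem tendsto_of_isOptimal [IsProbabilityMeasure μ] (hW : IsBrownianReal W μ) (hr : 0 < r)
    (hσ : 0 < σ) (hT : 0 < T) (hα₁ : 0 < α₁) (hα₂ : 0 < α₂) {Pstar : ℝ → ℝ → ℝ}
    (hopt : ∀ θ : ℝ, 0 < θ → IsOptimal r v σ T x₁ α₁ α₂ θ μ W (Pstar θ)) {t : ℝ}
    (ht : t ∈ Icc 0 T) :
    Tendsto (fun θ => Pstar θ t) atTop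
      (𝓝 (rationalDecision r v σ T α₂ t + asymptoticShift r v σ T α₁ α₂)) := by
  set p := rationalDecision r v σ T α₂ with hp
  set A := curvature r σ T α₁ with hA
  set k := slope r v T with hk
  set G := utilityExponent r v σ T x₁ α₁ with hG
  set c := asymptoticShift r v σ T α₁ α₂ with hc
  have hpc : Continuous p := continuous_rationalDecision r v σ T α₂
  have hAc : Continuous A := continuous_curvature r σ T α₁
  have hkc : Continuous k := continuous_slope r v T
  have hcd : ∀ t, HasDerivAt (fun s => p s + c) (r * p t) t := fun t =>
    (hasDerivAt_rationalDecision r v σ T α₂ t).add_const c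
  have hX := isWealth_wealthPath (r := r) (v := v) (σ := σ) (x := x₁) (T := T) hW hcd (by fun_prop)
  have hrc : EqOn (rate T fun s => p s + c) (fun t => r * p t) (Icc 0 T) :=
    fun t ht => rate_eq_of_hasDerivAt hT hcd ht
  have hfeas : IsFeasible r v σ T α₂ fun s => p s + c :=
    isFeasible_iff.2 ⟨isDecision_of_hasDerivAt hcd (by fun_prop), hrc ⟨le_rfl, hT.le⟩,
      hrc ⟨hT.le, le_rfl⟩⟩
  have hℓc : Continuous fun s => A s * (p s + c) - k s := by fun_prop
  obtain ⟨M, hM⟩ := isCompact_Icc.exists_bound_of_continuousOn (s := Icc 0 T) hℓc.continuousOn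
  set C := 2 / α₁ * Real.exp (G fun s => p s + c) with hC
  set η : ℝ → ℝ := fun θ => √(T * C / θ) with hη
  have hbound : ∀ θ : ℝ, 0 < θ → (Pstar θ t - (p t + c)) ^ 2 ≤
      4 * M * η θ / (α₁ * σ ^ 2) + 8 * η θ ^ 2 := by
    intro θ hθ
    obtain ⟨hf, X, hXw, -, hbest⟩ := hopt θ hθ
    obtain ⟨Q, Q', hQ, hQ', hQe, hQr⟩ := hf.1.exists_extension hT
    have hQc : Continuous Q := continuous_iff_continuousAt.2 fun t => (hQ t).continuousAt
    have hcmp := hbest _ _ hfeas hX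
      (hX.integrable_utility_and_integral_eq hW hT.le hcd (by fun_prop) α₁).1
    rw [objective_eq hW hT hQ hQ' hQe hQr hXw,
      objective_eq hW hT hcd (by fun_prop) (fun _ _ => rfl) hrc hX] at hcmp
    change -(1 / α₁) * Real.exp (G fun s => p s + c) -
      θ * (1 / 2 * ∫ t in (0 : ℝ)..T, (r * p t - r * p t) ^ 2) ≤ -(1 / α₁) * Real.exp (G Q) -
      θ * (1 / 2 * ∫ t in (0 : ℝ)..T, (Q' t - r * p t) ^ 2) at hcmp
    simp only [sub_self, ne_eq, OfNat.ofNat_ne_zero, not_false_eq_true, zero_pow,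
      intervalIntegral.integral_zero, mul_zero, sub_zero] at hcmp
    have hD0 := integral_sq_nonneg hT.le fun t => Q' t - r * p t
    set D := ∫ t in (0 : ℝ)..T, (Q' t - r * p t) ^ 2 with hD
    -- The competitor `p + c` has no disparity, so the optimal decision must be at least as good in
    -- utility alone.
    have hGle : G Q ≤ G fun s => p s + c := by
      have h1 : 1 / α₁ * Real.exp (G Q) ≤ 1 / α₁ * Real.exp (G fun s => p s + c) := by
        have := mul_nonneg hθ.le hD0
        linarith
      exact Real.exp_le_exp.1 (le_of_mul_le_mul_left h1 (by positivity))
    -- The same comparison bounds the penalty `θ D / 2` by the utility loss `exp (G (p + c)) / α₁`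
    -- of the competitor.
    have hDle : T * D ≤ η θ ^ 2 := by
      have hC0 : 0 ≤ C := by positivity
      rw [hη, Real.sq_sqrt (by positivity), le_div_iff₀ hθ]
      have h1 : 0 ≤ 1 / α₁ * Real.exp (G Q) := by positivity
      have h2 : θ * D ≤ C := by
        rw [hC, show 2 / α₁ = 2 * (1 / α₁) by ring]; linarith
      nlinarith
    have hquad := utilityExponent_add r v σ T x₁ α₁ (P := fun s => p s + c)
      (h := fun s => Q s - (p s + c)) (by fun_prop) (by fun_prop)
    simp only [add_sub_cancel] at hquad
    have hq : (∫ s in (0 : ℝ)..T, (A s * (p s + c) - k s) * (Q s - (p s + c))) +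
        ∫ s in (0 : ℝ)..T, A s * (Q s - (p s + c)) ^ 2 / 2 ≤ 0 := by
      change G Q = G _ + α₁ * (_ + _) at hquad
      by_contra! h
      have := mul_pos hα₁ h
      linarith
    have hres := sq_le_of_quadratic_nonpos (a₀ := α₁ * σ ^ 2) (M := M) (η := η θ) hT hAc
      (by positivity) (fun s hs => ?_) hℓc hM
      (integral_marginal_asymptoticShift hr hσ hα₁ hα₂)
      (w := fun s => Q s - (p s + c)) (w' := fun s => Q' s - r * p s)
      (fun s => (hQ s).fun_sub (hcd s)) (by fun_prop) (Real.sqrt_nonneg _) hDle hq t ht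
    · rwa [hQe ht]
    -- The curvature is smallest at the horizon, where it equals `α₁ σ²`.
    · have h1 : 1 ≤ Real.exp (r * (T - s)) := Real.one_le_exp (mul_nonneg hr.le (by linarith [hs.2]))
      have h2 : 1 ≤ Real.exp (r * (T - s)) ^ 2 := one_le_pow₀ h1
      exact le_mul_of_one_le_right (by positivity) h2
  have hη0 : Tendsto η atTop (𝓝 0) := by
    have h1 : Tendsto (fun θ : ℝ => T * C / θ) atTop (𝓝 0) := tendsto_const_nhds.div_atTop tendsto_id
    simpa using h1.sqrt
  have hB0 : Tendsto (fun θ => 4 * M * η θ / (α₁ * σ ^ 2) + 8 * η θ ^ 2) atTop (𝓝 0) := by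
    have h1 := ((hη0.const_mul (4 * M)).div_const (α₁ * σ ^ 2)).add ((hη0.pow 2).const_mul 8)
    simpa using h1
  have hsq : Tendsto (fun θ => (Pstar θ t - (p t + c)) ^ 2) atTop (𝓝 0) :=
    squeeze_zero' (Eventually.of_forall fun θ => sq_nonneg _)
      ((eventually_gt_atTop 0).mono hbound) hB0
  have habs : Tendsto (fun θ => |Pstar θ t - (p t + c)|) atTop (𝓝 0) := by
    have := hsq.sqrt
    simpa only [Real.sqrt_sq_eq_abs, Real.sqrt_zero] using this
  exact tendsto_sub_nhds_zero_iff.1 ((tendsto_zero_iff_abs_tendsto_zero _).2 habs)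

end Objective

/-! ### The crossing time and the comparison of decisions -/

/-- The quotient in the logarithm is `1 / (exp (r T) + 1)` by the difference of squares. The value
is the last factor of `asymptoticShift`, so the limiting shift is the gap between the rational
decisions at the crossing time. -/
lemma exp_crossingTime {r T : ℝ} (hr : 0 < r) (hT : 0 < T) :
    Real.exp (r * (crossingTime r T - T)) = 2 / (Real.exp (r * T) + 1) := by
  have hE : 1 < Real.exp (r * T) := Real.one_lt_exp_iff.2 (mul_pos hr hT)
  have e2 : Real.exp (2 * r * T) = Real.exp (r * T) ^ 2 := by
    rw [← Real.exp_nat_mul]; ring_nf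
  have h1 : (Real.exp (r * T) - 1) / (Real.exp (2 * r * T) - 1) = 1 / (Real.exp (r * T) + 1) := by
    have h3 : Real.exp (r * T) - 1 ≠ 0 := by linarith
    have h4 : Real.exp (r * T) + 1 ≠ 0 := by linarith
    rw [e2, show Real.exp (r * T) ^ 2 - 1 = (Real.exp (r * T) - 1) * (Real.exp (r * T) + 1) by ring]
    field_simp
  have h2 : r * (crossingTime r T - T) = Real.log (1 / (Real.exp (r * T) + 1)) + Real.log 2 := by
    unfold crossingTime
    rw [h1]
    field_simp
    ring
  rw [h2, Real.exp_add, Real.exp_log (by positivity), Real.exp_log (by norm_num)]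
  ring

/-- Equivalent to `exp (-r T) ≤ 2 / (exp (r T) + 1) ≤ 1`. -/
lemma crossingTime_mem_Icc {r T : ℝ} (hr : 0 < r) (hT : 0 < T) : crossingTime r T ∈ Icc 0 T := by
  have hE : 1 < Real.exp (r * T) := Real.one_lt_exp_iff.2 (mul_pos hr hT)
  have h := exp_crossingTime hr hT
  constructor
  · have h1 : Real.exp (r * (0 - T)) ≤ Real.exp (r * (crossingTime r T - T)) := by
      rw [h, zero_sub, mul_neg, Real.exp_neg, ← one_div, div_le_div_iff₀ (by linarith)
        (by linarith)]
      linarith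
    have h2 := le_of_mul_le_mul_left (Real.exp_le_exp.1 h1) hr
    linarith
  · have h1 : Real.exp (r * (crossingTime r T - T)) ≤ 1 := by
      rw [h, div_le_one (by linarith)]
      linarith
    have h2 := Real.exp_le_one_iff.1 h1
    by_contra! h3
    have := mul_pos hr (sub_pos.2 h3)
    linarith

lemma rationalDecision_eq_add (r v σ T α₁ α₂ t : ℝ) :
    rationalDecision r v σ T α₁ t = rationalDecision r v σ T α₂ t +
      v / σ ^ 2 * (1 / α₁ - 1 / α₂) * Real.exp (r * (t - T)) := by
  simp only [rationalDecision, div_mul_eq_div_div_swap]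
  ring

end DecisionImitation

theorem theorem7 {Ω : Type*} [MeasurableSpace Ω] (μ : Measure Ω) [IsProbabilityMeasure μ]
    (W : ℝ≥0 → Ω → ℝ) (hW : IsBrownianReal W μ)
    (r v σ T x₁ α₁ α₂ : ℝ) (hr : 0 < r) (hv : 0 < v) (hσ : 0 < σ) (hT : 0 < T)
    (hα₁ : 0 < α₁) (hα₂ : 0 < α₂) :
    DecisionImitation.crossingTime r T ∈ Icc 0 T ∧
    (∃ Pinf : ℝ → ℝ, DecisionImitation.IsAsymptoticDecision r v σ T x₁ α₁ α₂ μ W Pinf) ∧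
    ∀ Pinf : ℝ → ℝ, DecisionImitation.IsAsymptoticDecision r v σ T x₁ α₁ α₂ μ W Pinf →
      (∀ t ∈ Icc 0 (DecisionImitation.crossingTime r T),
        (α₁ < α₂ →
          Pinf t ≥ DecisionImitation.rationalDecision r v σ T α₁ t ∧
          DecisionImitation.rationalDecision r v σ T α₁ t >
            DecisionImitation.rationalDecision r v σ T α₂ t) ∧
        (α₁ > α₂ →
          Pinf t ≤ DecisionImitation.rationalDecision r v σ T α₁ t ∧
          DecisionImitation.rationalDecision r v σ T α₁ t <
            DecisionImitation.rationalDecision r v σ T α₂ t)) ∧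
      (∀ t ∈ Icc (DecisionImitation.crossingTime r T) T,
        (α₁ < α₂ →
          DecisionImitation.rationalDecision r v σ T α₁ t ≥ Pinf t ∧
          Pinf t > DecisionImitation.rationalDecision r v σ T α₂ t) ∧
        (α₁ > α₂ →
          DecisionImitation.rationalDecision r v σ T α₁ t ≤ Pinf t ∧
          Pinf t < DecisionImitation.rationalDecision r v σ T α₂ t)) := by
  open DecisionImitation in
  have hτ := crossingTime_mem_Icc hr hT
  have hexpτ := exp_crossingTime hr hT
  refine ⟨hτ, ?_, ?_⟩
  · have h : ∀ θ : ℝ, ∃ P : ℝ → ℝ, 0 < θ → IsOptimal r v σ T x₁ α₁ α₂ θ μ W P := fun θ => by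
      by_cases hθ : 0 < θ
      · obtain ⟨P, hP⟩ := exists_isOptimal (r := r) (v := v) (x₁ := x₁) (α₂ := α₂) hW hσ hT hα₁ hθ
        exact ⟨P, fun _ => hP⟩
      · exact ⟨0, fun h => absurd h hθ⟩
    choose Pstar hPstar using h
    exact ⟨_, Pstar, hPstar, fun t ht => tendsto_of_isOptimal hW hr hσ hT hα₁ hα₂ hPstar ht⟩
  rintro Pinf ⟨Pstar, hopt, hlim⟩
  -- Uniqueness of limits fixes every asymptotic decision on `[0, T]`. With the shift written as an
  -- exponential at the crossing time, each comparison is one of `exp (r (t - T))` at two times.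
  have hPinf : ∀ t ∈ Icc 0 T, Pinf t = rationalDecision r v σ T α₂ t +
      v / σ ^ 2 * (1 / α₁ - 1 / α₂) * Real.exp (r * (crossingTime r T - T)) := fun t ht => by
    rw [hexpτ]
    exact tendsto_nhds_unique (hlim t ht)
      (tendsto_of_isOptimal hW hr hσ hT hα₁ hα₂ hopt ht)
  have hvσ : 0 < v / σ ^ 2 := by positivity
  have hpos : α₁ < α₂ → 0 < v / σ ^ 2 * (1 / α₁ - 1 / α₂) := fun h =>
    mul_pos hvσ (sub_pos.2 (one_div_lt_one_div_of_lt hα₁ h))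
  have hneg : α₁ > α₂ → v / σ ^ 2 * (1 / α₁ - 1 / α₂) < 0 := fun h =>
    mul_neg_of_pos_of_neg hvσ (sub_neg.2 (one_div_lt_one_div_of_lt hα₂ h))
  have hmono : ∀ {s t : ℝ}, s ≤ t → Real.exp (r * (s - T)) ≤ Real.exp (r * (t - T)) := fun h =>
    Real.exp_le_exp.2 (mul_le_mul_of_nonneg_left (by linarith) hr.le)
  refine ⟨fun t ht => ?_, fun t ht => ?_⟩
  · rw [hPinf t ⟨ht.1, ht.2.trans hτ.2⟩, rationalDecision_eq_add r v σ T α₁ α₂ t]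
    refine ⟨fun h => ⟨?_, ?_⟩, fun h => ⟨?_, ?_⟩⟩
    · linarith [mul_le_mul_of_nonneg_left (hmono ht.2) (hpos h).le]
    · linarith [mul_pos (hpos h) (Real.exp_pos (r * (t - T)))]
    · linarith [mul_le_mul_of_nonpos_left (hmono ht.2) (hneg h).le]
    · linarith [mul_neg_of_neg_of_pos (hneg h) (Real.exp_pos (r * (t - T)))]
  · rw [hPinf t ⟨hτ.1.trans ht.1, ht.2⟩, rationalDecision_eq_add r v σ T α₁ α₂ t]
    refine ⟨fun h => ⟨?_, ?_⟩, fun h => ⟨?_, ?_⟩⟩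
    · linarith [mul_le_mul_of_nonneg_left (hmono ht.1) (hpos h).le]
    · linarith [mul_pos (hpos h) (Real.exp_pos (r * (crossingTime r T - T)))]
    · linarith [mul_le_mul_of_nonpos_left (hmono ht.1) (hneg h).le]
    · linarith [mul_neg_of_neg_of_pos (hneg h) (Real.exp_pos (r * (crossingTime r T - T)))]
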